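/- **Networks.** A network with $m$ inputs, $d$ outputs, $h\ge 0$ hidden layers and non-linearity $\sigma:\mathbb R\to\mathbb R$ computes $g_\theta(x)=b_{h+1}+W_{h+1}\sigma(b_h+W_h\cdots\sigma(b_1+W_1x))$, with $\sigma$ applied coordinatewise. An architecture consists of the (positive) widths of the hidden layers and of the set of weights and biases that are present (absent ones are $0$). Its number of parameters is the number of weights and biases present, and it is fully connected if all of them are present. A network is used by a player either as the function $f_\theta=g_\theta$ (any $\sigma$), or, if $m=1$, $h\ge1$ and $\sigma(x)=\max(0,x)$, as the distribution $q_\theta$ on $\mathbb R^d$ of $g_\theta(z)$ with $z$ uniform on $[0,1]$. For each player the numbers $m,d,h$, the non-linearity, and the use (function or distribution) are fixed. **Games.** Let $p\in\mathbb N$ and $R,L,D>0$, $\tilde L\ge 0$. The players pick parameters $w$ and $\theta$ in $[-R,R]^{p_1}$ and $[-R,R]^{p_2}$ of architectures with $p_1,p_2\le p$ parameters, and the payoff is $\varphi(w,\theta)=\tilde\varphi(f_w,q_\theta)$, where $f_w,q_\theta$ are the models (functions or distributions) of the two players. The function $\tilde\varphi$ is bilinear in the sense that it preserves convex combinations (pointwise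 averages of functions, mixtures of distributions) in each of its arguments, on the convex hulls of the two sets of models; $|\varphi|\le D$; and, for any two architectures, $\varphi$ is $L$-Lipschitz for the Euclidean norm of $(w,\theta)$. If a player picks distributions, $\tilde\varphi$ is moreover $\tilde L$-Lipschitz in that player's argument, on the convex hulls, for the total variation distance $\sup_S|\mu(S)-\nu(S)|$. **Theorem.** There is an absolute constant $c>0$ such that, for all such games and every $\varepsilon>0$, with $$p_\varepsilon:=\min\Big(p,\Big\lfloor \frac{c\,\varepsilon}{D}\sqrt{\frac{p}{\log(4LR\sqrt p/\varepsilon)}}\Big\rfloor\Big)$$ (read as $0$ if the logarithm is not positive), there is a single pair $(w^*,\theta^*)$ of parameter vectors with entries in $[-R,R]$, of architectures with at most $p$ parameters, such that $$\varphi(w,\theta^*)\le\varphi(w^*,\theta)+\varepsilon+e$$ for all parameters $w,\theta$, with entries in $[-R_\varepsilon,R_\varepsilon]$, of fully connected networks with at most $p_\varepsilon$ parameters (with the inputs, outputs and number of hidden layers of the respective player). Here: 1. (function vs function) $e=0$ and $R_\varepsilon=R$; 2. (function vs distribution, in either order) $e=\tilde L/R$ and $R_\varepsilon=R\,p_\varepsilon/p$;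 3. (distribution vs distribution) $e=2\tilde L/R$ and $R_\varepsilon=R\,p_\varepsilon/p$; where in cases 2 and 3 the networks with at most $p_\varepsilon$ parameters that generate distributions are restricted to those that map $[0,1]$ into $[0,1]^d$ and are constant on $(-\infty,0]$ and on $[1,\infty)$. -/

import Mathlib

open MeasureTheory
open scoped NNReal

noncomputable section

namespace NetGame

/-! ### Fully connected layers, networks, architectures -/

/-- The weights and biases of an affine layer from `m` inputs to `n` outputs: `(i, some j)` is the
weight from input `j` to output `i`, and `(i, none)` is the bias of output `i`. -/
abbrev LayerIdx (m n : ℕ) : Type := Fin n × Option (Fin m)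

/-- The map `x ↦ b + W x`. -/
def affineLayer {m n : ℕ} (w : LayerIdx m n → ℝ) (x : Fin m → ℝ) : Fin n → ℝ :=
  fun i => w (i, none) + ∑ j, w (i, some j) * x j

/-- All possible weights and biases of a layered network with `m` inputs, the given list of widths
of the hidden layers, and `d` outputs. -/
def ParamIdx (d : ℕ) : ℕ → List ℕ → Type
  | m, [] => LayerIdx m d
  | m, n :: ns => LayerIdx m n ⊕ ParamIdx d n ns

/-- There are finitely many weights and biases. -/
instance instFintypeParamIdx (d : ℕ) : (m : ℕ) → (ns : List ℕ) → Fintype (ParamIdx d m ns)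
  | m, [] => inferInstanceAs (Fintype (LayerIdx m d))
  | m, n :: ns =>
    letI := instFintypeParamIdx d n ns
    inferInstanceAs (Fintype (LayerIdx m n ⊕ ParamIdx d n ns))

/-- The function `x ↦ b_l + W_l σ(b_{l-1} + W_{l-1} ⋯ σ(b_1 + W_1 x))`, with `σ` applied
coordinatewise. -/
def netFun (σ : ℝ → ℝ) (d : ℕ) :
    (m : ℕ) → (ns : List ℕ) → (ParamIdx d m ns → ℝ) → (Fin m → ℝ) → (Fin d → ℝ)
  | _, [], w, x => affineLayer w x
  | _, n :: ns, w, x =>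
    netFun σ d n ns (fun i => w (Sum.inr i)) (fun i => σ (affineLayer (fun e => w (Sum.inl e)) x i))

/-- An architecture with `m` inputs, `h` (nonempty) hidden layers and `d` outputs: the widths of the
hidden layers, and the set of those weights and biases that are present. The others are `0` and are
not parameters. -/
structure Arch (m h d : ℕ) where
  hidden : List ℕ
  length_hidden : hidden.length = h
  hidden_pos : ∀ n ∈ hidden, 0 < n
  conn : Finset (ParamIdx d m hidden)

namespace Arch

variable {m h d : ℕ}

/-- The number of parameters. -/
def numParams (A : Arch m h d) : ℕ := A.conn.card

/-- All weights and biases between consecutive layers are present. -/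
def FullyConnected (A : Arch m h d) : Prop := A.conn = Finset.univ

/-- Parameter vectors of an architecture, with the Euclidean norm. -/
abbrev Params (A : Arch m h d) : Type := EuclideanSpace ℝ A.conn

open Classical in
/-- The function computed by the network with architecture `A` and parameters `w`. -/
def fn (A : Arch m h d) (σ : ℝ → ℝ) (w : A.Params) : (Fin m → ℝ) → (Fin d → ℝ) :=
  netFun σ d m A.hidden (fun i => if hi : i ∈ A.conn then w ⟨i, hi⟩ else 0)

/-- The parameter box `[-R, R]^p`. -/
def box (A : Arch m h d) (R : ℝ) : Set A.Params := {w | ∀ i, |w i| ≤ R}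

end Arch

/-! ### Models: functions and distributions -/

/-- A parametrized family of models with values in `E`: the shape of the networks, the model
represented by a parameter vector, and the side condition imposed on subnetworks. -/
structure ModelClass (E : Type) where
  inputs : ℕ
  hiddenLayers : ℕ
  outputs : ℕ
  model : (A : Arch inputs hiddenLayers outputs) → A.Params → E
  admissible : (A : Arch inputs hiddenLayers outputs) → A.Params → Prop

/-- Networks with non-linearity `σ` regarded as functions; no side condition on subnetworks. -/
def functionClass (σ : ℝ → ℝ) (m h d : ℕ) : ModelClass ((Fin m → ℝ) → (Fin d → ℝ)) where
  inputs := m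
  hiddenLayers := h
  outputs := d
  model A w := A.fn σ w
  admissible _ _ := True

/-- The rectified linear unit. -/
def relu (x : ℝ) : ℝ := max 0 x

/-- The generator `ℝ → ℝ^d` given by a ReLU network with one-dimensional input. -/
def generator {h d : ℕ} (A : Arch 1 h d) (w : A.Params) (z : ℝ) : Fin d → ℝ :=
  A.fn relu w (fun _ => z)

/-- ReLU networks with one-dimensional input, regarded as the law of `g_θ(z)` for `z` uniform on
`[0,1]`. The subnetworks are required to take values in `[0,1]^d` on `[0,1]` and to be constant on
each side of `[0,1]`. -/
def distributionClass (h d : ℕ) : ModelClass (Measure (Fin d → ℝ)) where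
  inputs := 1
  hiddenLayers := h
  outputs := d
  model A w := (volume.restrict (Set.Icc (0 : ℝ) 1)).map (generator A w)
  admissible A w :=
    (∀ z ∈ Set.Icc (0 : ℝ) 1, ∀ i, generator A w z i ∈ Set.Icc (0 : ℝ) 1) ∧
    (∀ z < 0, generator A w z = generator A w 0) ∧
    (∀ z > 1, generator A w z = generator A w 1)

/-- The total variation distance `sup_S |μ(S) - ν(S)|` of two probability measures. -/
def tvDist {X : Type*} [MeasurableSpace X] (μ ν : Measure X) : ℝ :=
  ⨆ S : {S : Set X // MeasurableSet S}, |μ.real S - ν.real S|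

/-- The models with at most `p` parameters in `[-R, R]`. -/
def ModelClass.models {E : Type} (M : ModelClass E) (p : ℕ) (R : ℝ) : Set E :=
  {f | ∃ A : Arch M.inputs M.hiddenLayers M.outputs,
    A.numParams ≤ p ∧ ∃ w ∈ A.box R, f = M.model A w}

/-- Their convex combinations: averages of functions, mixtures of distributions. -/
def ModelClass.hull {E : Type} [AddCommMonoid E] [Module ℝ≥0 E]
    (M : ModelClass E) (p : ℕ) (R : ℝ) : Set E :=
  convexHull ℝ≥0 (M.models p R)

/-! ### Games -/

/-- The game `φ(w, θ) = Φ(f_w, q_θ)` between networks with at most `p` parameters in `[-R, R]`: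
the models' payoff `Φ` is bilinear with respect to convex combinations of models, and
`φ` is bounded by `D` and `L`-Lipschitz for the Euclidean norm of the parameters `(w, θ)`. -/
structure IsGame {E F : Type} [AddCommMonoid E] [Module ℝ≥0 E] [AddCommMonoid F] [Module ℝ≥0 F]
    (M₁ : ModelClass E) (M₂ : ModelClass F) (Φ : E → F → ℝ) (p : ℕ) (R L D : ℝ) : Prop where
  linear_left : ∀ f ∈ M₁.hull p R, ∀ f' ∈ M₁.hull p R, ∀ q ∈ M₂.hull p R, ∀ a b : ℝ≥0,
    a + b = 1 → Φ (a • f + b • f') q = a * Φ f q + b * Φ f' q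
  linear_right : ∀ f ∈ M₁.hull p R, ∀ q ∈ M₂.hull p R, ∀ q' ∈ M₂.hull p R, ∀ a b : ℝ≥0,
    a + b = 1 → Φ f (a • q + b • q') = a * Φ f q + b * Φ f q'
  bounded : ∀ A : Arch M₁.inputs M₁.hiddenLayers M₁.outputs, A.numParams ≤ p →
    ∀ B : Arch M₂.inputs M₂.hiddenLayers M₂.outputs, B.numParams ≤ p →
    ∀ w ∈ A.box R, ∀ θ ∈ B.box R, |Φ (M₁.model A w) (M₂.model B θ)| ≤ D
  lipschitz : ∀ A : Arch M₁.inputs M₁.hiddenLayers M₁.outputs, A.numParams ≤ p →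
    ∀ B : Arch M₂.inputs M₂.hiddenLayers M₂.outputs, B.numParams ≤ p →
    ∀ w ∈ A.box R, ∀ w' ∈ A.box R, ∀ θ ∈ B.box R, ∀ θ' ∈ B.box R,
    |Φ (M₁.model A w) (M₂.model B θ) - Φ (M₁.model A w') (M₂.model B θ')|
      ≤ L * √(‖w - w'‖ ^ 2 + ‖θ - θ'‖ ^ 2)

/-- The payoff is `K`-Lipschitz in the distribution of the first player, in total variation. -/
def TVLipschitzLeft {d : ℕ} {F : Type} [AddCommMonoid F] [Module ℝ≥0 F]
    (M₁ : ModelClass (Measure (Fin d → ℝ))) (M₂ : ModelClass F)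
    (Φ : Measure (Fin d → ℝ) → F → ℝ) (p : ℕ) (R K : ℝ) : Prop :=
  ∀ q ∈ M₁.hull p R, ∀ q' ∈ M₁.hull p R, ∀ f ∈ M₂.hull p R,
    |Φ q f - Φ q' f| ≤ K * tvDist q q'

/-- The payoff is `K`-Lipschitz in the distribution of the second player, in total variation. -/
def TVLipschitzRight {d : ℕ} {E : Type} [AddCommMonoid E] [Module ℝ≥0 E]
    (M₁ : ModelClass E) (M₂ : ModelClass (Measure (Fin d → ℝ)))
    (Φ : E → Measure (Fin d → ℝ) → ℝ) (p : ℕ) (R K : ℝ) : Prop :=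
  ∀ f ∈ M₁.hull p R, ∀ q ∈ M₂.hull p R, ∀ q' ∈ M₂.hull p R,
    |Φ f q - Φ f q'| ≤ K * tvDist q q'

/-- There is a pair of parameter vectors `(w*, θ*)` of networks with at most `p` parameters in
`[-R, R]` such that `max_w φ(w, θ*) ≤ min_θ φ(w*, θ) + err`, where `w` and `θ` range over the
parameters in `[-R', R']` of all admissible fully connected networks, with the same number of layers,
that have at most `p'` parameters. -/
def HasLimitedCapacityEquilibrium {E F : Type} (M₁ : ModelClass E) (M₂ : ModelClass F)
    (Φ : E → F → ℝ) (p : ℕ) (R : ℝ) (p' : ℕ) (R' err : ℝ) : Prop :=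
  ∃ A : Arch M₁.inputs M₁.hiddenLayers M₁.outputs, A.numParams ≤ p ∧
  ∃ B : Arch M₂.inputs M₂.hiddenLayers M₂.outputs, B.numParams ≤ p ∧
  ∃ wStar ∈ A.box R, ∃ θStar ∈ B.box R,
    ∀ S : Arch M₁.inputs M₁.hiddenLayers M₁.outputs, S.FullyConnected → S.numParams ≤ p' →
    ∀ T : Arch M₂.inputs M₂.hiddenLayers M₂.outputs, T.FullyConnected → T.numParams ≤ p' →
    ∀ w ∈ S.box R', M₁.admissible S w → ∀ θ ∈ T.box R', M₂.admissible T θ →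
      Φ (M₁.model S w) (M₂.model B θStar) ≤ Φ (M₁.model A wStar) (M₂.model T θ) + err

/-- The size `p_ε = min(p, ⌊c (ε/D) √(p / log(4 L R √p / ε))⌋)` of the subnetworks. -/
def subnetSize (c ε D L R : ℝ) (p : ℕ) : ℕ :=
  min p ⌊c * (ε / D) * √(p / Real.log (4 * L * R * √p / ε))⌋₊

/-- The bound `R_ε = R p_ε / p` on the parameters of the subnetworks. -/
def subnetBound (c ε D L R : ℝ) (p : ℕ) : ℝ :=
  R * subnetSize c ε D L R p / p

end NetGame

end

/-! Fix the size `s` of the subnetworks. Up to a change of payoff of `ε/4` per player, they form a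
finite family: the widths are encoded by one of `2 ^ s` compositions of `s + 1`, and the at most `s`
parameters are rounded to a grid of mesh `ε / (4 L √p)` (`ModelClass.exists_net`). The logarithm of
the number of classes is at most `4 s log Λ` with `Λ = 4 L R √p / ε` (`log_card_net_le`).

In the resulting finite matrix game, each side runs multiplicative weights while the other answers
with a pure best response. The best responses of `k` rounds, played uniformly, are optimal up to
`ε/2` as soon as `k ≥ 256 (D/ε)² s log Λ` (`exists_sparse_equilibrium`). The minimax theorem is not
needed: weak duality round by round links the two runs.

It remains to replace a uniform mixture of `k` small networks by one network with at most `p`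
parameters; the definition of `p_ε` guarantees `20 k s ≤ p` (`mul_mixture_size_le`). For functions,
the networks are put side by side and their output layers are divided by `k`, which gives the
average exactly (`Realizes.average`).

For distributions, `[0,1]` is cut into `k` equal slots, and the `i`-th generator is run at higher
speed in the `i`-th slot, except for a fraction `1/(2R)` of each slot that is reserved for
transitions. A subnetwork is constant on each side of `[0,1]`, so two ramps suffice to make it
vanish outside of its slot and the adjacent gaps (`Realizes.bump`), and the sum of these bumps runs
through all curves (`exists_concatenation`). The total variation error is at most the total
transition time (`tvDist_map_mix_le`). The bound `R p_ε / p` on the parameters keeps the jumps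
small, the accelerated weights below `R`, and the summed output biases below `R`.

The bookkeeping is done with `Realizes`, a layer-by-layer predicate counting nonzero parameters. It
has a separate bound `β` for the output biases, since these are added when networks are added. -/

namespace NetGame

/-! ### Multiplicative weights -/

section MultiplicativeWeights

variable {I J : Type*} [Fintype I]

/-- The exponential weights of a vector of cumulative payoffs. -/
noncomputable def expWeights (η : ℝ) (S : I → ℝ) (i : I) : ℝ :=
  Real.exp (η * S i) / ∑ a, Real.exp (η * S a)

lemma expWeights_nonneg (η : ℝ) (S : I → ℝ) (i : I) : 0 ≤ expWeights η S i :=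
  div_nonneg (Real.exp_pos _).le (Finset.sum_nonneg fun _ _ => (Real.exp_pos _).le)

lemma sum_exp_pos [Nonempty I] (f : I → ℝ) : 0 < ∑ a, Real.exp (f a) :=
  Finset.sum_pos (fun _ _ => Real.exp_pos _) Finset.univ_nonempty

lemma sum_expWeights [Nonempty I] (η : ℝ) (S : I → ℝ) : ∑ i, expWeights η S i = 1 := by
  simp only [expWeights, ← Finset.sum_div]
  exact div_self (sum_exp_pos _).ne'

/-- Cumulative payoffs when the opponent answers the exponential weights according to `br`. -/
noncomputable def cumPayoff (M : I → J → ℝ) (η : ℝ) (br : (I → ℝ) → J) : ℕ → I → ℝ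
  | 0 => 0
  | t + 1 => fun i => cumPayoff M η br t i + M i (br (expWeights η (cumPayoff M η br t)))

lemma cumPayoff_eq_sum (M : I → J → ℝ) (η : ℝ) (br : (I → ℝ) → J) (T : ℕ) (i : I) :
    cumPayoff M η br T i =
      ∑ t ∈ Finset.range T, M i (br (expWeights η (cumPayoff M η br t))) := by
  induction T with
  | zero => simp [cumPayoff]
  | succ T ih => rw [Finset.sum_range_succ, ← ih]; rfl

lemma exp_le_one_add_add_sq {x : ℝ} (hx : |x| ≤ 1) : Real.exp x ≤ 1 + x + x ^ 2 := by
  have := (abs_le.1 (Real.abs_exp_sub_one_sub_id_le hx)).2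
  linarith

/-- Potential argument: as `exp x ≤ 1 + x + x²` for `|x| ≤ 1`, a round multiplies the sum of the
exponentials by at most the exponential of `η` times the mean payoff plus `η² D²`. -/
lemma sum_exp_cumPayoff_le [Nonempty I] (M : I → J → ℝ) {η D : ℝ} (hη : 0 < η)
    (hD : η * D ≤ 1) (hM : ∀ i j, |M i j| ≤ D) (br : (I → ℝ) → J) (T : ℕ) :
    ∑ i, Real.exp (η * cumPayoff M η br T i) ≤
      Fintype.card I * Real.exp (∑ t ∈ Finset.range T,
        (η * (∑ i, expWeights η (cumPayoff M η br t) i *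
          M i (br (expWeights η (cumPayoff M η br t)))) + η ^ 2 * D ^ 2)) := by
  induction T with
  | zero => simp [cumPayoff]
  | succ T ih =>
    rw [Finset.sum_range_succ, Real.exp_add, ← mul_assoc]
    set S := cumPayoff M η br T
    set j := br (expWeights η S)
    set Z := ∑ i, Real.exp (η * S i)
    have hZ : 0 < Z := sum_exp_pos _
    have step : ∑ i, Real.exp (η * cumPayoff M η br (T + 1) i) ≤
        Z * Real.exp (η * (∑ i, expWeights η S i * M i j) + η ^ 2 * D ^ 2) := by
      calc ∑ i, Real.exp (η * cumPayoff M η br (T + 1) i)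
          = ∑ i, Real.exp (η * S i) * Real.exp (η * M i j) := by
            refine Finset.sum_congr rfl fun i _ => ?_
            rw [← Real.exp_add, ← mul_add]; rfl
        _ ≤ ∑ i, Real.exp (η * S i) * (1 + η * M i j + η ^ 2 * D ^ 2) := by
            refine Finset.sum_le_sum fun i _ => mul_le_mul_of_nonneg_left ?_ (Real.exp_pos _).le
            have h1 : |η * M i j| ≤ 1 := by
              rw [abs_mul, abs_of_pos hη]
              exact (mul_le_mul_of_nonneg_left (hM i j) hη.le).trans hD
            have h2 : M i j ^ 2 ≤ D ^ 2 := sq_le_sq' (abs_le.1 (hM i j)).1 (abs_le.1 (hM i j)).2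
            have h3 := exp_le_one_add_add_sq h1
            rw [mul_pow] at h3
            nlinarith [mul_le_mul_of_nonneg_left h2 (sq_nonneg η)]
        _ = Z * (η * (∑ i, expWeights η S i * M i j) + η ^ 2 * D ^ 2 + 1) := by
            have h4 : Z * ∑ i, expWeights η S i * M i j = ∑ i, Real.exp (η * S i) * M i j := by
              rw [Finset.mul_sum]
              refine Finset.sum_congr rfl fun i _ => ?_
              rw [expWeights, div_mul_eq_mul_div, mul_div_cancel₀ _ hZ.ne']
            have h5 : ∑ i, Real.exp (η * S i) * (1 + η * M i j + η ^ 2 * D ^ 2) =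
                Z + η * (∑ i, Real.exp (η * S i) * M i j) + Z * (η ^ 2 * D ^ 2) := by
              rw [Finset.mul_sum, Finset.sum_mul, ← Finset.sum_add_distrib,
                ← Finset.sum_add_distrib]
              exact Finset.sum_congr rfl fun i _ => by ring
            rw [h5, ← h4]; ring
        _ ≤ _ := mul_le_mul_of_nonneg_left (Real.add_one_le_exp _) hZ.le
    exact step.trans (mul_le_mul_of_nonneg_right ih (Real.exp_pos _).le)

/-- The regret bound for multiplicative weights. -/
lemma regret_bound [Nonempty I] (M : I → J → ℝ) {η D : ℝ} (hη : 0 < η)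
    (hD : η * D ≤ 1) (hM : ∀ i j, |M i j| ≤ D) (br : (I → ℝ) → J) (T : ℕ) :
    ∃ P : ℕ → I → ℝ, (∀ t i, 0 ≤ P t i) ∧ (∀ t, ∑ i, P t i = 1) ∧ ∀ a,
      ∑ t ∈ Finset.range T, M a (br (P t)) ≤
        ∑ t ∈ Finset.range T, ∑ i, P t i * M i (br (P t)) +
          (Real.log (Fintype.card I) / η + T * (η * D ^ 2)) := by
  refine ⟨fun t => expWeights η (cumPayoff M η br t), fun _ _ => expWeights_nonneg _ _ _,
    fun _ => sum_expWeights _ _, fun a => ?_⟩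
  have h1 := sum_exp_cumPayoff_le M hη hD hM br T
  -- The potential dominates the term of the fixed action `a`; taking logarithms gives the regret
  -- against `a`.
  have h2 : Real.exp (η * cumPayoff M η br T a) ≤ _ :=
    (Finset.single_le_sum (f := fun i => Real.exp (η * cumPayoff M η br T i))
      (fun i _ => (Real.exp_pos _).le) (Finset.mem_univ a)).trans h1
  have hN : (0 : ℝ) < Fintype.card I := by exact_mod_cast Fintype.card_pos
  rw [← Real.exp_log hN, ← Real.exp_add, Real.exp_le_exp, cumPayoff_eq_sum,
    Finset.sum_add_distrib, ← Finset.mul_sum] at h2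
  simp only [Finset.sum_const, Finset.card_range, nsmul_eq_mul] at h2
  refine le_of_mul_le_mul_left (h2.trans (le_of_eq ?_)) hη
  field_simp
  ring

/-- A finite matrix game has approximately optimal mixed strategies that are uniform on `T` pure
strategies. -/
lemma exists_sparse_equilibrium [Fintype J] [Nonempty I] [Nonempty J] (M : I → J → ℝ) {η D : ℝ}
    (hη : 0 < η) (hD : η * D ≤ 1) (hM : ∀ i j, |M i j| ≤ D) (T : ℕ) :
    ∃ (x : ℕ → I) (y : ℕ → J), ∀ a b,
      ∑ t ∈ Finset.range T, M a (y t) ≤ ∑ t ∈ Finset.range T, M (x t) b +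
        (Real.log (Fintype.card I) / η + Real.log (Fintype.card J) / η + 2 * T * (η * D ^ 2)) := by
  have hbr : ∀ P : I → ℝ, ∃ j, ∀ j', ∑ i, P i * M i j ≤ ∑ i, P i * M i j' := fun P =>
    Finite.exists_min fun j => ∑ i, P i * M i j
  have hbr' : ∀ Q : J → ℝ, ∃ i, ∀ i', ∑ j, Q j * M i' j ≤ ∑ j, Q j * M i j := fun Q =>
    Finite.exists_max fun i => ∑ j, Q j * M i j
  choose br hbr using hbr
  choose br' hbr' using hbr'
  -- Two independent runs: rows learn against best-responding columns, and columns learn, with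
  -- payoff `-M`, against best-responding rows. The pure best responses, not the weights, form the
  -- sparse strategies.
  obtain ⟨P, hP0, hP1, hP⟩ := regret_bound M hη hD hM br T
  obtain ⟨Q, hQ0, hQ1, hQ⟩ := regret_bound (fun j i => - M i j) hη hD
    (fun j i => by rw [abs_neg]; exact hM i j) br' T
  refine ⟨fun t => br' (Q t), fun t => br (P t), fun a b => ?_⟩
  -- Weak duality: both sides are compared with the payoff of `P t` against `Q t`.
  have key : ∀ t, ∑ i, P t i * M i (br (P t)) ≤ ∑ j, Q t j * M (br' (Q t)) j := fun t => by
    calc ∑ i, P t i * M i (br (P t))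
        = ∑ j, Q t j * ∑ i, P t i * M i (br (P t)) := by rw [← Finset.sum_mul, hQ1, one_mul]
      _ ≤ ∑ j, Q t j * ∑ i, P t i * M i j :=
          Finset.sum_le_sum fun j _ => mul_le_mul_of_nonneg_left (hbr _ j) (hQ0 t j)
      _ = ∑ i, P t i * ∑ j, Q t j * M i j := by
          simp only [Finset.mul_sum]
          rw [Finset.sum_comm]
          exact Finset.sum_congr rfl fun i _ => Finset.sum_congr rfl fun j _ => by ring
      _ ≤ ∑ i, P t i * ∑ j, Q t j * M (br' (Q t)) j :=
          Finset.sum_le_sum fun i _ => mul_le_mul_of_nonneg_left (hbr' _ i) (hP0 t i)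
      _ = _ := by rw [← Finset.sum_mul, hP1, one_mul]
  have h1 := hP a
  have h2 := hQ b
  simp only [mul_neg, Finset.sum_neg_distrib] at h2
  have h3 := Finset.sum_le_sum fun t (_ : t ∈ Finset.range T) => key t
  linarith

end MultiplicativeWeights

/-! ### Functions computed by networks with few nonzero parameters -/

open Classical in
/-- The number of parameters needed to represent the weight `x`. -/
noncomputable def nz (x : ℝ) : ℕ := if x = 0 then 0 else 1

@[simp] lemma nz_zero : nz 0 = 0 := if_pos rfl

lemma nz_le_one (x : ℝ) : nz x ≤ 1 := by unfold nz; split_ifs <;> simp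

lemma nz_add_le (x y : ℝ) : nz (x + y) ≤ nz x + nz y := by
  by_cases hx : x = 0
  · simp [hx]
  · have : nz x = 1 := if_neg hx
    have := nz_le_one (x + y)
    omega

lemma nz_mul_le_left (x y : ℝ) : nz (x * y) ≤ nz x := by
  by_cases hx : x = 0
  · simp [hx]
  · have : nz x = 1 := if_neg hx
    have := nz_le_one (x * y)
    omega

lemma nz_mul_le_right (x y : ℝ) : nz (x * y) ≤ nz y := mul_comm x y ▸ nz_mul_le_left y x

lemma nz_sum_le {ι : Type*} (s : Finset ι) (f : ι → ℝ) : nz (∑ i ∈ s, f i) ≤ ∑ i ∈ s, nz (f i) := by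
  classical
  induction s using Finset.induction_on with
  | empty => simp
  | insert a s ha ih =>
    rw [Finset.sum_insert ha, Finset.sum_insert ha]
    exact (nz_add_le _ _).trans (Nat.add_le_add_left ih _)

lemma sum_nz_eq_card {ι : Type*} [Fintype ι] (f : ι → ℝ) :
    ∑ i, nz (f i) = (Finset.univ.filter fun i => f i ≠ 0).card := by
  classical
  rw [Finset.card_filter]
  exact Finset.sum_congr rfl fun i _ => by unfold nz; split_ifs <;> simp_all

/-- The number of nonzero weights and biases of an affine map. -/
noncomputable def affSize {m n : ℕ} (b : Fin n → ℝ) (W : Fin n → Fin m → ℝ) : ℕ :=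
  ∑ i, (nz (b i) + ∑ j, nz (W i j))

/-- The affine map `x ↦ b + W x`. -/
def affMap {m n : ℕ} (b : Fin n → ℝ) (W : Fin n → Fin m → ℝ) (x : Fin m → ℝ) (i : Fin n) : ℝ :=
  b i + ∑ j, W i j * x j

/-- `Realizes σ R β h m p f`: the function `f` is computed by a network with non-linearity `σ`,
`m` inputs, `h` hidden layers, at most `p` nonzero parameters bounded by `R`, with the exception of
the biases of the output layer, which are bounded by `β`. -/
def Realizes (σ : ℝ → ℝ) {d : ℕ} (R β : ℝ) :
    ℕ → (m : ℕ) → ℕ → ((Fin m → ℝ) → Fin d → ℝ) → Prop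
  | 0, m, p, f => ∃ (b : Fin d → ℝ) (W : Fin d → Fin m → ℝ), (∀ i, |b i| ≤ β) ∧
      (∀ i j, |W i j| ≤ R) ∧ affSize b W ≤ p ∧ ∀ x, f x = affMap b W x
  | h + 1, m, p, f => ∃ (n : ℕ) (b : Fin n → ℝ) (W : Fin n → Fin m → ℝ)
      (q : ℕ) (g : (Fin n → ℝ) → Fin d → ℝ), 0 < n ∧ (∀ i, |b i| ≤ R) ∧ (∀ i j, |W i j| ≤ R) ∧
      affSize b W + q ≤ p ∧ Realizes σ R β h n q g ∧ ∀ x, f x = g fun i => σ (affMap b W x i)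

namespace Realizes

variable {σ : ℝ → ℝ} {d : ℕ} {R β : ℝ}

lemma mono {R' β' : ℝ} (hR : R ≤ R') (hβ : β ≤ β') {h m p p' : ℕ} (hp : p ≤ p')
    {f : (Fin m → ℝ) → Fin d → ℝ} (hf : Realizes σ R β h m p f) : Realizes σ R' β' h m p' f := by
  induction h generalizing m p p' with
  | zero =>
    obtain ⟨b, W, hb, hW, hs, hf⟩ := hf
    exact ⟨b, W, fun i => (hb i).trans hβ, fun i j => (hW i j).trans hR, hs.trans hp, hf⟩
  | succ h ih =>
    obtain ⟨n, b, W, q, g, hn, hb, hW, hs, hg, hf⟩ := hf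
    exact ⟨n, b, W, q, g, hn, fun i => (hb i).trans hR, fun i j => (hW i j).trans hR, hs.trans hp,
      ih le_rfl hg, hf⟩

/-- Realizable functions come from parameter vectors with small support. -/
lemma exists_netFun (hR : β ≤ R) {h m p : ℕ} {f : (Fin m → ℝ) → Fin d → ℝ}
    (hf : Realizes σ R β h m p f) :
    ∃ ns : List ℕ, ns.length = h ∧ (∀ n ∈ ns, 0 < n) ∧ ∃ w : ParamIdx d m ns → ℝ,
      (∀ i, |w i| ≤ R) ∧ ∑ i, nz (w i) ≤ p ∧ netFun σ d m ns w = f := by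
  induction h generalizing m p with
  | zero =>
    obtain ⟨b, W, hb, hW, hs, hf⟩ := hf
    refine ⟨[], rfl, by simp, fun i : LayerIdx m d => i.2.elim (b i.1) (W i.1), ?_, ?_, ?_⟩
    · rintro ⟨i, _ | j⟩
      · exact (hb i).trans hR
      · exact hW i j
    · change ∑ i : LayerIdx m d, nz (i.2.elim (b i.1) (W i.1)) ≤ p
      simpa [Fintype.sum_prod_type, affSize] using hs
    · funext x
      rw [hf]
      rfl
  | succ h ih =>
    obtain ⟨n, b, W, q, g, hn, hb, hW, hs, hg, hf⟩ := hf
    obtain ⟨ns, hl, hpos, w, hw, hws, hwf⟩ := ih hg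
    refine ⟨n :: ns, by simp [hl], by simpa using ⟨hn, hpos⟩,
      Sum.elim (fun i : LayerIdx m n => i.2.elim (b i.1) (W i.1)) w, ?_, ?_, ?_⟩
    · rintro (⟨i, _ | j⟩ | i)
      · exact hb i
      · exact hW i j
      · exact hw i
    · change ∑ i : LayerIdx m n ⊕ ParamIdx d n ns,
        nz (Sum.elim (fun i : LayerIdx m n => i.2.elim (b i.1) (W i.1)) w i) ≤ p
      rw [Fintype.sum_sum_type]
      simp only [Sum.elim_inl, Sum.elim_inr, Fintype.sum_prod_type, Fintype.sum_option,
        Option.elim_none, Option.elim_some]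
      exact (Nat.add_le_add_left hws _).trans hs
    · funext x
      rw [hf, ← hwf]
      rfl

lemma of_netFun {r : ℝ} {m : ℕ} {ns : List ℕ} (hpos : ∀ n ∈ ns, 0 < n) (w : ParamIdx d m ns → ℝ)
    (hw : ∀ i, |w i| ≤ r) :
    Realizes σ r r ns.length m (∑ i, nz (w i)) (netFun σ d m ns w) := by
  induction ns generalizing m with
  | nil =>
    refine ⟨fun i => w (i, none), fun i j => w (i, some j), fun i => hw _, fun i j => hw _, ?_,
      fun x => rfl⟩
    change _ ≤ ∑ i : LayerIdx m d, nz (w i)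
    simp [Fintype.sum_prod_type, affSize]
  | cons n ns ih =>
    refine ⟨n, fun i => w (Sum.inl (i, none)), fun i j => w (Sum.inl (i, some j)), _, _,
      hpos n (by simp), fun i => hw _, fun i j => hw _, ?_,
      ih (fun k hk => hpos k (by simp [hk])) (fun i => w (Sum.inr i)) (fun i => hw _), fun x => rfl⟩
    change _ ≤ ∑ i : LayerIdx m n ⊕ ParamIdx d n ns, nz (w i)
    rw [Fintype.sum_sum_type]
    simp [Fintype.sum_prod_type, affSize]

lemma zero (hR : 0 ≤ R) (hβ : 0 ≤ β) (h m p : ℕ) :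
    Realizes σ (d := d) R β h m p 0 := by
  induction h generalizing m with
  | zero => exact ⟨0, 0, by simp [hβ], by simp [hR], by simp [affSize], fun x => by ext; simp [affMap]⟩
  | succ h ih =>
    exact ⟨1, 0, 0, p, 0, one_pos, by simp [hR], by simp [hR], by simp [affSize], ih 1, fun x => rfl⟩

/-- Networks can be put in parallel. -/
lemma par {β₁ β₂ : ℝ} (hR : 0 ≤ R) {h m₁ m₂ p₁ p₂ : ℕ} {f₁ : (Fin m₁ → ℝ) → Fin d → ℝ}
    {f₂ : (Fin m₂ → ℝ) → Fin d → ℝ}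
    (h₁ : Realizes σ R β₁ h m₁ p₁ f₁) (h₂ : Realizes σ R β₂ h m₂ p₂ f₂) :
    Realizes σ R (β₁ + β₂) h (m₁ + m₂) (p₁ + p₂)
      (fun x => f₁ (fun i => x (Fin.castAdd m₂ i)) + f₂ (fun i => x (Fin.natAdd m₁ i))) := by
  induction h generalizing m₁ m₂ p₁ p₂ with
  | zero =>
    obtain ⟨b₁, W₁, hb₁, hW₁, hs₁, hf₁⟩ := h₁
    obtain ⟨b₂, W₂, hb₂, hW₂, hs₂, hf₂⟩ := h₂
    refine ⟨fun i => b₁ i + b₂ i, fun i => Fin.addCases (W₁ i) (W₂ i),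
      fun i => (abs_add_le _ _).trans (add_le_add (hb₁ i) (hb₂ i)), fun i j => ?_, ?_, fun x => ?_⟩
    · induction j using Fin.addCases with
      | left j => simpa using hW₁ i j
      | right j => simpa using hW₂ i j
    · refine le_trans ?_ (add_le_add hs₁ hs₂)
      rw [affSize, affSize, affSize, ← Finset.sum_add_distrib]
      refine Finset.sum_le_sum fun i _ => ?_
      simp only [Fin.sum_univ_add, Fin.addCases_left, Fin.addCases_right]
      have := nz_add_le (b₁ i) (b₂ i)
      omega
    · funext i
      simp only [hf₁, hf₂, Pi.add_apply, affMap, Fin.sum_univ_add, Fin.addCases_left,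
        Fin.addCases_right]
      ring
  | succ h ih =>
    obtain ⟨n₁, b₁, W₁, q₁, g₁, hn₁, hb₁, hW₁, hs₁, hg₁, hf₁⟩ := h₁
    obtain ⟨n₂, b₂, W₂, q₂, g₂, hn₂, hb₂, hW₂, hs₂, hg₂, hf₂⟩ := h₂
    -- Block-diagonal weights; the zero blocks cost no parameters.
    refine ⟨n₁ + n₂, Fin.addCases b₁ b₂,
      Fin.addCases (fun i => Fin.addCases (W₁ i) 0) (fun i => Fin.addCases 0 (W₂ i)), _, _,
      by omega, fun i => ?_, fun i j => ?_, ?_, ih hg₁ hg₂, fun x => ?_⟩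
    · induction i using Fin.addCases with
      | left i => simpa using hb₁ i
      | right i => simpa using hb₂ i
    · induction i using Fin.addCases with
      | left i =>
        induction j using Fin.addCases with
        | left j => simpa using hW₁ i j
        | right j => simpa using hR
      | right i =>
        induction j using Fin.addCases with
        | left j => simpa using hR
        | right j => simpa using hW₂ i j
    · have : affSize (m := m₁ + m₂) (n := n₁ + n₂) (Fin.addCases b₁ b₂)
          (Fin.addCases (fun i => Fin.addCases (W₁ i) 0) (fun i => Fin.addCases 0 (W₂ i))) =
          affSize b₁ W₁ + affSize b₂ W₂ := by
        simp [affSize, Fin.sum_univ_add]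
      omega
    · simp [hf₁, hf₂, affMap, Fin.sum_univ_add]

/-- Networks with at least one hidden layer can be added. -/
lemma add {β₁ β₂ : ℝ} (hR : 0 ≤ R) {h m p₁ p₂ : ℕ} {f₁ f₂ : (Fin m → ℝ) → Fin d → ℝ}
    (h₁ : Realizes σ R β₁ (h + 1) m p₁ f₁) (h₂ : Realizes σ R β₂ (h + 1) m p₂ f₂) :
    Realizes σ R (β₁ + β₂) (h + 1) m (p₁ + p₂) (f₁ + f₂) := by
  obtain ⟨n₁, b₁, W₁, q₁, g₁, hn₁, hb₁, hW₁, hs₁, hg₁, hf₁⟩ := h₁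
  obtain ⟨n₂, b₂, W₂, q₂, g₂, hn₂, hb₂, hW₂, hs₂, hg₂, hf₂⟩ := h₂
  -- Only the first layers share their input; the remaining layers run in parallel on disjoint
  -- inputs, so no two weights are added.
  refine ⟨n₁ + n₂, Fin.addCases b₁ b₂, Fin.addCases W₁ W₂, _, _,
    by omega, fun i => ?_, fun i j => ?_, ?_, par hR hg₁ hg₂, fun x => ?_⟩
  · induction i using Fin.addCases with
    | left i => simpa using hb₁ i
    | right i => simpa using hb₂ i
  · induction i using Fin.addCases with
    | left i => simpa using hW₁ i j
    | right i => simpa using hW₂ i j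
  · have : affSize (m := m) (n := n₁ + n₂) (Fin.addCases b₁ b₂) (Fin.addCases W₁ W₂) =
        affSize b₁ W₁ + affSize b₂ W₂ := by
      simp [affSize, Fin.sum_univ_add]
    omega
  · simp [hf₁, hf₂, affMap]

lemma sum (hR : 0 ≤ R) {h m p k : ℕ} {f : ℕ → (Fin m → ℝ) → Fin d → ℝ}
    (hf : ∀ i < k, Realizes σ R β (h + 1) m p (f i)) :
    Realizes σ R (k * β) (h + 1) m (k * p) (∑ i ∈ Finset.range k, f i) := by
  induction k with
  | zero => simpa using zero hR le_rfl _ _ _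
  | succ k ih =>
    rw [Finset.sum_range_succ]
    refine ((ih fun i hi => hf i (by omega)).add hR (hf k (by omega))).mono le_rfl (le_of_eq ?_)
      (le_of_eq ?_)
    · push_cast; ring
    · ring

lemma affSize_mul_le {m n : ℕ} (a : ℝ) (b : Fin n → ℝ) (W : Fin n → Fin m → ℝ) :
    affSize (fun i => a * b i) (fun i j => a * W i j) ≤ affSize b W :=
  Finset.sum_le_sum fun _ _ => add_le_add (nz_mul_le_right _ _)
    (Finset.sum_le_sum fun _ _ => nz_mul_le_right _ _)

/-- The factor goes into the output layer alone, so `σ` need not be homogeneous. -/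
lemma smul {a : ℝ} (ha0 : 0 ≤ a) (ha1 : a ≤ 1) {h m p : ℕ} {f : (Fin m → ℝ) → Fin d → ℝ}
    (hf : Realizes σ R β h m p f) : Realizes σ R (a * β) h m p (a • f) := by
  induction h generalizing m p with
  | zero =>
    obtain ⟨b, W, hb, hW, hs, hf⟩ := hf
    refine ⟨fun i => a * b i, fun i j => a * W i j, fun i => ?_, fun i j => ?_,
      (affSize_mul_le a b W).trans hs, fun x => ?_⟩
    · rw [abs_mul, abs_of_nonneg ha0]
      exact mul_le_mul_of_nonneg_left (hb i) ha0
    · rw [abs_mul, abs_of_nonneg ha0]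
      exact (mul_le_of_le_one_left (abs_nonneg _) ha1).trans (hW i j)
    · funext i
      simp [hf, affMap, mul_add, Finset.mul_sum, mul_assoc]
  | succ h ih =>
    obtain ⟨n, b, W, q, g, hn, hb, hW, hs, hg, hf⟩ := hf
    exact ⟨n, b, W, q, a • g, hn, hb, hW, hs, ih hg, fun x => by simp [hf]⟩

/-- Averages of `k` networks. -/
lemma average (hR : 0 ≤ R) {h m p k : ℕ} (hk : 0 < k) {f : ℕ → (Fin m → ℝ) → Fin d → ℝ}
    (hf : ∀ i < k, Realizes σ R R h m p (f i)) :
    Realizes σ R R h m (k * p) (∑ i ∈ Finset.range k, (k : ℝ)⁻¹ • f i) := by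
  have hk' : (0 : ℝ) < k := by exact_mod_cast hk
  have hk1 : (k : ℝ)⁻¹ ≤ 1 := inv_le_one_of_one_le₀ (by exact_mod_cast hk)
  -- Without hidden layers there is nothing to stack: the affine maps themselves are averaged.
  -- Otherwise the `k` output biases, scaled by `1 / k`, add up to at most `R`.
  rcases h with _ | h
  · have : ∀ i, ∃ (b : Fin d → ℝ) (W : Fin d → Fin m → ℝ), i < k → (∀ i, |b i| ≤ R) ∧
        (∀ i j, |W i j| ≤ R) ∧ affSize b W ≤ p ∧ ∀ x, f i x = affMap b W x := fun i => by
      by_cases hi : i < k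
      · obtain ⟨b, W, hh⟩ := hf i hi
        exact ⟨b, W, fun _ => hh⟩
      · exact ⟨0, 0, fun h => absurd h hi⟩
    choose b W hbW using this
    have bound : ∀ x : ℕ → ℝ, (∀ t < k, |x t| ≤ R) →
        |∑ t ∈ Finset.range k, (k : ℝ)⁻¹ * x t| ≤ R := fun x hx => by
      rw [← Finset.mul_sum, abs_mul, abs_of_pos (inv_pos.2 hk'), inv_mul_le_iff₀ hk']
      refine (Finset.abs_sum_le_sum_abs _ _).trans ((Finset.sum_le_card_nsmul _ _ R
        fun t ht => hx t (Finset.mem_range.1 ht)).trans (by simp))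
    refine ⟨fun i => ∑ t ∈ Finset.range k, (k : ℝ)⁻¹ * b t i,
      fun i j => ∑ t ∈ Finset.range k, (k : ℝ)⁻¹ * W t i j,
      fun _ => bound _ fun t ht => (hbW t ht).1 _, fun _ _ => bound _ fun t ht => (hbW t ht).2.1 _ _,
      ?_, fun x => ?_⟩
    · calc _ ≤ ∑ i, (∑ t ∈ Finset.range k, nz (b t i) +
            ∑ j, ∑ t ∈ Finset.range k, nz (W t i j)) :=
          Finset.sum_le_sum fun i _ => add_le_add
            ((nz_sum_le _ _).trans (Finset.sum_le_sum fun _ _ => nz_mul_le_right _ _))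
            (Finset.sum_le_sum fun j _ =>
              (nz_sum_le _ _).trans (Finset.sum_le_sum fun _ _ => nz_mul_le_right _ _))
        _ = ∑ t ∈ Finset.range k, affSize (b t) (W t) := by
          simp only [affSize]
          rw [Finset.sum_comm]
          refine Finset.sum_congr rfl fun i _ => ?_
          rw [Finset.sum_add_distrib, Finset.sum_comm (s := Finset.univ)]
        _ ≤ k * p := (Finset.sum_le_card_nsmul _ _ p
            fun t ht => (hbW t (Finset.mem_range.1 ht)).2.2.1).trans (by simp)
    · funext i
      rw [Finset.sum_apply, Finset.sum_apply, affMap]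
      simp only [Pi.smul_apply, smul_eq_mul]
      rw [Finset.sum_congr rfl fun t ht => by rw [(hbW t (Finset.mem_range.1 ht)).2.2.2 x]]
      simp only [affMap, mul_add, Finset.sum_add_distrib, Finset.mul_sum, Finset.sum_mul]
      rw [Finset.sum_comm]
      simp only [mul_assoc]
  · refine (sum hR fun i hi => (hf i hi).smul (inv_nonneg.2 hk'.le) hk1).mono le_rfl
      (le_of_eq ?_) le_rfl
    field_simp

/-- Reparametrization of a one-dimensional input. -/
lemma comp_affine {r a t : ℝ} (hr : r ≤ R) (hrβ : r ≤ β) (hat : r * (1 + |t|) ≤ R)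
    (ha : r * |a| ≤ R) {h p : ℕ} {f : (Fin 1 → ℝ) → Fin d → ℝ}
    (hf : Realizes σ r r (h + 1) 1 p f) :
    Realizes σ R β (h + 1) 1 (2 * p) (fun x => f fun _ => a * x 0 + t) := by
  obtain ⟨n, b, W, q, g, hn, hb, hW, hs, hg, hf⟩ := hf
  -- A weight of the first layer may create a bias where none was present, hence the factor 2 in the
  -- size.
  refine ⟨n, fun i => b i + W i 0 * t, fun i j => W i 0 * a, q, g, hn, fun i => ?_, fun i j => ?_,
    ?_, hg.mono hr hrβ le_rfl, fun x => ?_⟩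
  · refine (abs_add_le _ _).trans (le_trans ?_ hat)
    rw [abs_mul, mul_add, mul_one]
    exact add_le_add (hb i) (mul_le_mul_of_nonneg_right (hW i 0) (abs_nonneg _))
  · rw [abs_mul]
    exact (mul_le_mul_of_nonneg_right (hW i 0) (abs_nonneg _)).trans ha
  · have : affSize (fun i => b i + W i 0 * t) (fun i (j : Fin 1) => W i 0 * a) ≤
        2 * affSize b W := by
      rw [affSize, affSize, Finset.mul_sum]
      refine Finset.sum_le_sum fun i _ => ?_
      simp only [Finset.univ_unique, Fin.default_eq_zero, Finset.sum_singleton]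
      have := nz_add_le (b i) (W i 0 * t)
      have := nz_mul_le_left (W i 0) t
      have := nz_mul_le_left (W i 0) a
      omega
    omega
  · beta_reduce
    rw [hf]
    congr 1
    funext i
    simp only [affMap, Finset.univ_unique, Fin.default_eq_zero, Finset.sum_singleton]
    congr 1
    ring

end Realizes

/-! ### Architectures and realizable functions -/

open Classical in
/-- The full parameter vector of a network. -/
noncomputable def Arch.extend {m h d : ℕ} (A : Arch m h d) (w : A.Params)
    (i : ParamIdx d m A.hidden) : ℝ :=
  if hi : i ∈ A.conn then w ⟨i, hi⟩ else 0

lemma Arch.fn_eq {m h d : ℕ} (A : Arch m h d) (σ : ℝ → ℝ) (w : A.Params) :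
    A.fn σ w = netFun σ d m A.hidden (A.extend w) := rfl

lemma Arch.abs_extend_le {m h d : ℕ} (A : Arch m h d) {w : A.Params} {r : ℝ} (hr : 0 ≤ r)
    (hw : w ∈ A.box r) (i : ParamIdx d m A.hidden) : |A.extend w i| ≤ r := by
  unfold Arch.extend
  split_ifs with hi
  · exact hw _
  · simpa

lemma Arch.sum_nz_extend_le {m h d : ℕ} (A : Arch m h d) (w : A.Params) :
    ∑ i, nz (A.extend w i) ≤ A.numParams := by
  rw [sum_nz_eq_card]
  refine Finset.card_le_card fun i hi => ?_
  by_contra hc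
  exact (Finset.mem_filter.1 hi).2 (dif_neg hc)

lemma Arch.realizes {m h d : ℕ} (A : Arch m h d) (σ : ℝ → ℝ) {w : A.Params} {r : ℝ} (hr : 0 ≤ r)
    (hw : w ∈ A.box r) : Realizes σ r r h m A.numParams (A.fn σ w) := by
  have := Realizes.of_netFun (σ := σ) A.hidden_pos _ (A.abs_extend_le hr hw)
  rw [A.length_hidden] at this
  exact this.mono le_rfl le_rfl (A.sum_nz_extend_le w)

lemma Realizes.exists_arch {σ : ℝ → ℝ} {d h m p : ℕ} {R : ℝ} {f : (Fin m → ℝ) → Fin d → ℝ}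
    (hf : Realizes σ R R h m p f) :
    ∃ A : Arch m h d, A.numParams ≤ p ∧ ∃ w ∈ A.box R, A.fn σ w = f := by
  classical
  obtain ⟨ns, hl, hpos, w, hw, hs, hf⟩ := hf.exists_netFun le_rfl
  refine ⟨⟨ns, hl, hpos, Finset.univ.filter fun i => w i ≠ 0⟩, ?_,
    WithLp.toLp 2 fun i => w i.1, fun i => hw _, ?_⟩
  · rw [sum_nz_eq_card] at hs
    exact hs
  · rw [Arch.fn_eq, ← hf]
    congr 1
    funext i
    by_cases hi : w i = 0 <;> simp [Arch.extend, hi]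

lemma Arch.fn_zero {m h d : ℕ} (A : Arch m h d) (σ : ℝ → ℝ) : A.fn σ 0 = 0 := by
  have h0 : ∀ (m : ℕ) (ns : List ℕ), netFun σ d m ns (fun _ => 0) = 0 := by
    intro m ns
    induction ns generalizing m with
    | nil => funext x i; simp [netFun, affineLayer]
    | cons n ns ih => funext x i; simp [netFun, ih]
  rw [Arch.fn_eq, ← h0 m A.hidden]
  congr 1
  funext i
  simp [Arch.extend]

/-! ### Ramps -/

lemma relu_of_nonneg {x : ℝ} (hx : 0 ≤ x) : relu x = x := max_eq_right hx

lemma relu_of_nonpos {x : ℝ} (hx : x ≤ 0) : relu x = 0 := max_eq_left hx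

lemma relu_nonneg (x : ℝ) : 0 ≤ relu x := le_max_left _ _

lemma relu_mono {x y : ℝ} (h : x ≤ y) : relu x ≤ relu y := max_le_max_left _ h

lemma abs_relu_le (x : ℝ) : |relu x| ≤ |x| := by
  rw [abs_of_nonneg (relu_nonneg x)]
  exact max_le (abs_nonneg x) (le_abs_self x)

lemma continuous_relu : Continuous relu := continuous_const.max continuous_id

/-- The number of parameters that suffice for a ramp made of `n` pairs of units in the first of
`h + 1` hidden layers. -/
def rampSize (d n : ℕ) : ℕ → ℕ
  | 0 => n * (4 + 2 * d)
  | h + 1 => 6 * n + h + d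

namespace Realizes

variable {d : ℕ} {R : ℝ}

/-- Networks of width one that forward a nonnegative number. -/
lemma exists_forward (hR : 1 ≤ R) (h : ℕ) (v : Fin d → ℝ) (hv : ∀ j, |v j| ≤ R) :
    ∃ g : (Fin 1 → ℝ) → Fin d → ℝ, Realizes relu R 0 h 1 (h + d) g ∧
      ∀ y, 0 ≤ y 0 → g y = fun j => v j * y 0 := by
  induction h with
  | zero =>
    refine ⟨_, ⟨0, fun j _ => v j, by simp, fun j _ => hv j, ?_, fun x => rfl⟩, fun y _ => ?_⟩
    · rw [affSize]
      refine (Finset.sum_le_card_nsmul _ _ 1 fun j _ => ?_).trans (by simp)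
      simpa using nz_le_one _
    · funext j; simp [affMap]
  | succ h ih =>
    obtain ⟨g, hg, hgv⟩ := ih
    -- A ReLU unit with weight 1 does not change a nonnegative number; `1 ≤ R` admits this weight.
    refine ⟨fun x => g fun i => relu (affMap 0 (fun _ _ => 1) x i),
      ⟨1, 0, fun _ _ => 1, h + d, g, one_pos, by simp; linarith, by simpa using hR, ?_, hg,
        fun x => rfl⟩, fun y hy => ?_⟩
    · have := nz_le_one 1
      simp [affSize]
      omega
    · beta_reduce
      rw [hgv _ (relu_nonneg (affMap _ _ _ _))]
      simp [affMap, relu_of_nonneg hy]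

lemma affSize_const_le {m n : ℕ} (b : Fin n → ℝ) (W : Fin n → Fin m → ℝ) :
    affSize b W ≤ n * (1 + m) := by
  rw [affSize]
  refine (Finset.sum_le_card_nsmul _ _ (1 + m) fun i _ => add_le_add (nz_le_one _)
    ((Finset.sum_le_card_nsmul _ _ 1 fun j _ => nz_le_one _).trans (by simp))).trans (by simp)

lemma affSize_zero_bias_le {m n : ℕ} (W : Fin n → Fin m → ℝ) :
    affSize 0 W ≤ n * m := by
  rw [affSize]
  refine (Finset.sum_le_card_nsmul _ _ m fun i _ => ?_).trans (by simp)
  simpa using (Finset.sum_le_card_nsmul Finset.univ (fun j => nz (W i j)) 1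
    fun j _ => nz_le_one _)

/-- Ramps `u (σ(α z + β₁) - σ(α z + β₂))`. -/
lemma ramp (hR : 1 ≤ R) {α β₁ β₂ : ℝ} (hα : |α| ≤ R) (hβ₁ : |β₁| ≤ R) (hβ₂ : |β₂| ≤ R)
    (hβ : β₂ ≤ β₁) {n : ℕ} (hn : 0 < n) (u : Fin d → ℝ) (hu : ∀ j, |u j| ≤ R * n) (h : ℕ) :
    Realizes relu R 0 (h + 1) 1 (rampSize d n h)
      (fun x j => u j * (relu (α * x 0 + β₁) - relu (α * x 0 + β₂))) := by
  have hn' : (0 : ℝ) < n := by exact_mod_cast hn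
  have hun : ∀ j, |u j / n| ≤ R := fun j => by
    rw [abs_div, abs_of_pos hn', div_le_iff₀ hn']
    exact hu j
  set b : Fin (n + n) → ℝ := Fin.addCases (fun _ => β₁) (fun _ => β₂) with hbdef
  have hb : ∀ i, |b i| ≤ R := fun i => by
    induction i using Fin.addCases with
    | left i => simpa [b] using hβ₁
    | right i => simpa only [b, Fin.addCases_right] using hβ₂
  have hs : affSize b (fun _ (_ : Fin 1) => α) ≤ 4 * n :=
    (affSize_const_le _ _).trans (by omega)
  rcases h with _ | h
  -- With a single hidden layer, `n` identical pairs of units feed the outputs directly, with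
  -- weights `± u j / n`; the repetition allows heights `u j` up to `R n`.
  · refine ⟨n + n, b, fun _ _ => α, n * (2 * d), _, by omega, hb, fun _ _ => hα, ?_,
      ⟨0, fun j => Fin.addCases (fun _ => u j / n) (fun _ => - (u j / n)), by simp, fun j i => ?_,
        ?_, fun x => rfl⟩, fun x => ?_⟩
    · rw [rampSize, mul_add]
      omega
    · induction i using Fin.addCases with
      | left i => simpa using hun j
      | right i => simpa only [Fin.addCases_right, abs_neg] using hun j
    · exact (affSize_zero_bias_le _).trans (le_of_eq (by ring))
    · funext j
      simp only [affMap, Pi.zero_apply, zero_add, Fin.sum_univ_add, Fin.addCases_left,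
        Fin.addCases_right, b, Finset.univ_unique, Fin.default_eq_zero, Finset.sum_singleton,
        Finset.sum_const, Finset.card_univ, Fintype.card_fin, nsmul_eq_mul]
      rw [add_comm β₁, add_comm β₂]
      field_simp
      ring
  -- With more layers, one unit collects the `n` pairs with weights `±1`. The collected number is
  -- nonnegative, so it passes through the remaining layers, and each output needs only one weight
  -- `u j / n`.
  · obtain ⟨g, hg, hgv⟩ := exists_forward hR h (fun j => u j / n) hun
    refine ⟨n + n, b, fun _ _ => α, 2 * n + (h + d),
      fun x => g fun i => relu (affMap 0 (fun _ => Fin.addCases (fun _ => 1) (fun _ => -1)) x i),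
      by omega, hb, fun _ _ => hα, ?_,
      ⟨1, 0, fun _ => Fin.addCases (fun _ => 1) (fun _ => -1), h + d, g, one_pos,
        by simp; linarith, fun j i => ?_, ?_, hg, fun x => rfl⟩, fun x => ?_⟩
    · rw [rampSize]
      omega
    · induction i using Fin.addCases with
      | left i => simpa only [Fin.addCases_left, abs_one] using hR
      | right i => simpa only [Fin.addCases_right, abs_neg, abs_one] using hR
    · have := affSize_zero_bias_le (n := 1) (m := n + n)
        (fun _ => Fin.addCases (fun _ => 1) (fun _ => -1))
      omega
    · beta_reduce
      rw [hgv _ (relu_nonneg (affMap _ _ _ _))]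
      funext j
      have hle := relu_mono (add_le_add_right hβ (α * x 0))
      have : affMap (n := 1) 0 (fun _ => Fin.addCases (fun _ => 1) (fun _ => -1))
          (fun i => relu (affMap b (fun _ (_ : Fin 1) => α) x i)) 0 =
          n * (relu (α * x 0 + β₁) - relu (α * x 0 + β₂)) := by
        simp only [affMap, Pi.zero_apply, zero_add, Fin.sum_univ_add, Fin.addCases_left,
          Fin.addCases_right, b, Finset.univ_unique, Fin.default_eq_zero, Finset.sum_singleton,
          Finset.sum_const, Finset.card_univ, Fintype.card_fin, nsmul_eq_mul]
        rw [add_comm β₁, add_comm β₂]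
        ring
      rw [this, relu_of_nonneg (mul_nonneg hn'.le (sub_nonneg.2 hle))]
      field_simp

/-- A network that runs through the curve `z ↦ f z`, `z ∈ [0, 1]`, on the interval `[t, t + ℓ]`, and
vanishes outside of `[t - δ, t + ℓ + δ]`. -/
lemma bump {r δ ℓ t : ℝ} (hR : 1 ≤ R) (hr0 : 0 ≤ r) (hδ : 0 < δ) (hℓ : 0 < ℓ) (ht0 : 0 ≤ t)
    (ht1 : t + ℓ + δ ≤ 1) (hrℓ : r * (1 + ℓ⁻¹) ≤ R) {h p n : ℕ} {f : (Fin 1 → ℝ) → Fin d → ℝ}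
    (hf : Realizes relu r r (h + 1) 1 p f)
    (hf0 : ∀ z < 0, (f fun _ => z) = f fun _ => 0) (hf1 : ∀ z > 1, (f fun _ => z) = f fun _ => 1)
    (hn : 0 < n) (hu0 : ∀ j, |f (fun _ => 0) j| ≤ R * δ * (R * n))
    (hu1 : ∀ j, |f (fun _ => 1) j| ≤ R * δ * (R * n)) :
    ∃ X, Realizes relu R r (h + 1) 1 (2 * p + 2 * rampSize d n h) X ∧
      (∀ z ≤ t - δ, (X fun _ => z) = 0) ∧ (∀ z, t + ℓ + δ ≤ z → (X fun _ => z) = 0) ∧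
      ∀ z ∈ Set.Icc t (t + ℓ), (X fun _ => z) = f fun _ => (z - t) / ℓ := by
  have hR0 : 0 < R := by linarith
  have hRδ : 0 < R * δ := mul_pos hR0 hδ
  have hℓ' : 0 < ℓ⁻¹ := inv_pos.2 hℓ
  -- The accelerated curve has the value `f 0` before time `t` and `f 1` after time `t + ℓ`.
  have e1 : Realizes relu R r (h + 1) 1 (2 * p) (fun x => f fun _ => ℓ⁻¹ * x 0 + - (t * ℓ⁻¹)) := by
    refine comp_affine (by nlinarith [mul_nonneg hr0 hℓ'.le]) le_rfl (le_trans ?_ hrℓ)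
      (le_trans ?_ hrℓ) hf
    · rw [abs_neg, abs_of_nonneg (by positivity)]
      have : t * ℓ⁻¹ ≤ 1 * ℓ⁻¹ := mul_le_mul_of_nonneg_right (by linarith) hℓ'.le
      nlinarith
    · rw [abs_of_pos hℓ']
      nlinarith
  have bnd : ∀ {a : ℝ}, |a| ≤ 1 → |R * a| ≤ R := fun {a} ha => by
    rw [abs_mul, abs_of_pos hR0]
    nlinarith
  have hu : ∀ v : Fin d → ℝ, (∀ j, |v j| ≤ R * δ * (R * n)) →
      ∀ j, |-(v j / (R * δ))| ≤ R * n := fun v hv j => by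
    rw [abs_neg, abs_div, abs_of_pos hRδ, div_le_iff₀ hRδ]
    linarith [hv j]
  -- This ramp is `-f 0` up to time `t - δ` and vanishes from `t` on; its mirror image `e3` is `0`
  -- up to `t + ℓ` and `-f 1` from `t + ℓ + δ` on.
  have e2 := ramp (d := d) (α := -R) (β₁ := R * t) (β₂ := R * (t - δ)) hR
    (by rw [abs_neg, abs_of_pos hR0]) (bnd (abs_le.2 ⟨by linarith, by linarith⟩))
    (bnd (abs_le.2 ⟨by linarith, by linarith⟩)) (by nlinarith) hn _ (hu _ hu0) h
  have e3 := ramp (d := d) (α := R) (β₁ := R * -(t + ℓ)) (β₂ := R * -(t + ℓ + δ)) hR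
    (by rw [abs_of_pos hR0]) (bnd (abs_le.2 ⟨by linarith, by linarith⟩))
    (bnd (abs_le.2 ⟨by linarith, by linarith⟩)) (by nlinarith) hn _ (hu _ hu1) h
  have hf0' : ∀ z ≤ 0, (f fun _ => z) = f fun _ => 0 := fun z hz => by
    rcases hz.lt_or_eq with hz | hz
    · exact hf0 z hz
    · rw [hz]
  have hf1' : ∀ z, 1 ≤ z → (f fun _ => z) = f fun _ => 1 := fun z hz => by
    rcases hz.lt_or_eq with hz | hz
    · exact hf1 z hz
    · rw [← hz]
  refine ⟨_, ((e1.add hR0.le e2).add hR0.le e3).mono le_rfl (by simp) (by omega), ?_, ?_, ?_⟩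
  · intro z hz
    funext j
    have a1 : (f fun _ => ℓ⁻¹ * z + - (t * ℓ⁻¹)) = f fun _ => 0 := hf0' _ (by nlinarith)
    simp only [Pi.add_apply, a1, Pi.zero_apply]
    rw [relu_of_nonneg (x := -R * z + R * t) (by nlinarith),
      relu_of_nonneg (x := -R * z + R * (t - δ)) (by nlinarith),
      relu_of_nonpos (x := R * z + R * -(t + ℓ)) (by nlinarith),
      relu_of_nonpos (x := R * z + R * -(t + ℓ + δ)) (by nlinarith)]
    field_simp
    ring
  · intro z hz
    funext j
    have a1 : (f fun _ => ℓ⁻¹ * z + - (t * ℓ⁻¹)) = f fun _ => 1 := hf1' _ (by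
      rw [show ℓ⁻¹ * z + - (t * ℓ⁻¹) = (z - t) / ℓ by field_simp; ring, le_div_iff₀ hℓ]
      linarith)
    simp only [Pi.add_apply, a1, Pi.zero_apply]
    rw [relu_of_nonpos (x := -R * z + R * t) (by nlinarith),
      relu_of_nonpos (x := -R * z + R * (t - δ)) (by nlinarith),
      relu_of_nonneg (x := R * z + R * -(t + ℓ)) (by nlinarith),
      relu_of_nonneg (x := R * z + R * -(t + ℓ + δ)) (by nlinarith)]
    field_simp
    ring
  · rintro z ⟨hz0, hz1⟩
    funext j
    have a1 : ℓ⁻¹ * z + - (t * ℓ⁻¹) = (z - t) / ℓ := by field_simp; ring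
    simp only [Pi.add_apply, a1]
    rw [relu_of_nonpos (x := -R * z + R * t) (by nlinarith),
      relu_of_nonpos (x := -R * z + R * (t - δ)) (by nlinarith),
      relu_of_nonpos (x := R * z + R * -(t + ℓ)) (by nlinarith),
      relu_of_nonpos (x := R * z + R * -(t + ℓ + δ)) (by nlinarith)]
    ring

end Realizes

/-! ### Sizes and values of fully connected networks -/

lemma card_paramIdx_nil (d m : ℕ) : Fintype.card (ParamIdx d m []) = d * (m + 1) := by
  change Fintype.card (LayerIdx m d) = _
  simp

lemma card_paramIdx_cons (d m n : ℕ) (ns : List ℕ) :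
    Fintype.card (ParamIdx d m (n :: ns)) = n * (m + 1) + Fintype.card (ParamIdx d n ns) := by
  change Fintype.card (LayerIdx m n ⊕ ParamIdx d n ns) = _
  simp

lemma outputs_le_card_paramIdx (d m : ℕ) (ns : List ℕ) :
    d ≤ Fintype.card (ParamIdx d m ns) := by
  induction ns generalizing m with
  | nil => rw [card_paramIdx_nil]; exact Nat.le_mul_of_pos_right _ (by omega)
  | cons n ns ih => rw [card_paramIdx_cons]; exact (ih n).trans (Nat.le_add_left _ _)

lemma sum_le_card_paramIdx (d m : ℕ) (ns : List ℕ) :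
    ns.sum ≤ Fintype.card (ParamIdx d m ns) := by
  induction ns generalizing m with
  | nil => simp
  | cons n ns ih =>
    rw [card_paramIdx_cons, List.sum_cons]
    exact add_le_add (Nat.le_mul_of_pos_right _ (by omega)) (ih n)

lemma length_le_card_paramIdx (d m : ℕ) {ns : List ℕ} (hpos : ∀ n ∈ ns, 0 < n) :
    ns.length ≤ Fintype.card (ParamIdx d m ns) :=
  (List.length_le_sum_of_one_le ns hpos).trans (sum_le_card_paramIdx d m ns)

/-- Each hidden unit has a bias and at least one incoming weight, because the preceding layer is
nonempty. -/
lemma two_mul_width_le_card_paramIdx (d : ℕ) {m : ℕ} (hm : 0 < m) {ns : List ℕ}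
    (hpos : ∀ n ∈ ns, 0 < n) {n : ℕ} (hn : n ∈ ns) : 2 * n ≤ Fintype.card (ParamIdx d m ns) := by
  induction ns generalizing m with
  | nil => simp at hn
  | cons a ns ih =>
    rw [card_paramIdx_cons]
    rcases List.mem_cons.1 hn with rfl | hn
    · nlinarith
    · exact (ih (hpos a (by simp)) (fun k hk => hpos k (by simp [hk])) hn).trans
        (Nat.le_add_left _ _)

lemma abs_affineLayer_le {m n : ℕ} {r : ℝ} (w : LayerIdx m n → ℝ) (hw : ∀ i, |w i| ≤ r)
    (x : Fin m → ℝ) (i : Fin n) : |affineLayer w x i| ≤ r * (1 + ∑ j, |x j|) := by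
  rw [affineLayer, mul_add, mul_one, Finset.mul_sum]
  refine (abs_add_le _ _).trans (add_le_add (hw _) ((Finset.abs_sum_le_sum_abs _ _).trans
    (Finset.sum_le_sum fun j _ => ?_)))
  rw [abs_mul]
  exact mul_le_mul_of_nonneg_right (hw _) (abs_nonneg _)

lemma sum_abs_relu_affineLayer_le {m n : ℕ} {r : ℝ} (hr : 0 ≤ r) (w : LayerIdx m n → ℝ)
    (hw : ∀ i, |w i| ≤ r) {x : Fin m → ℝ} (hx : ∑ j, |x j| ≤ 1) :
    ∑ i, |relu (affineLayer w x i)| ≤ n * (2 * r) := by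
  refine (Finset.sum_le_card_nsmul _ _ (2 * r) fun i _ => ?_).trans (by simp)
  refine (abs_relu_le _).trans ((abs_affineLayer_le w hw x i).trans ?_)
  nlinarith

/-- An input of `ℓ¹` norm at most 1 makes every unit at most `2 r`; by `n * (2 * r) ≤ 1` the next
layer again receives a vector of `ℓ¹` norm at most 1. -/
lemma abs_netFun_le {d m : ℕ} {ns : List ℕ} {r : ℝ} (hr : 0 ≤ r)
    (hns : ∀ n ∈ ns, n * (2 * r) ≤ 1) (w : ParamIdx d m ns → ℝ) (hw : ∀ i, |w i| ≤ r)
    {x : Fin m → ℝ} (hx : ∑ j, |x j| ≤ 1) (i : Fin d) : |netFun relu d m ns w x i| ≤ 2 * r := by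
  induction ns generalizing m with
  | nil =>
    refine (abs_affineLayer_le w hw x i).trans ?_
    nlinarith
  | cons n ns ih =>
    exact ih (fun k hk => hns k (by simp [hk])) _ (fun i => hw _)
      ((sum_abs_relu_affineLayer_le hr _ (fun i => hw _) hx).trans (hns n (by simp)))

lemma abs_netFun_singleton_le {d m n : ℕ} {r : ℝ} (hr : 0 ≤ r) (w : ParamIdx d m [n] → ℝ)
    (hw : ∀ i, |w i| ≤ r) {x : Fin m → ℝ} (hx : ∑ j, |x j| ≤ 1) (i : Fin d) :
    |netFun relu d m [n] w x i| ≤ r * (1 + n * (2 * r)) := by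
  refine (abs_affineLayer_le (fun i => w (Sum.inr i)) (fun i => hw _) _ i).trans ?_
  exact mul_le_mul_of_nonneg_left (add_le_add_right
    (sum_abs_relu_affineLayer_le hr _ (fun i => hw _) hx) 1) hr

lemma Arch.card_of_fullyConnected {m h d : ℕ} {A : Arch m h d} (hA : A.FullyConnected) :
    Fintype.card (ParamIdx d m A.hidden) = A.numParams := by
  rw [Arch.numParams, hA, Finset.card_univ]

/-- The jumps at the ends of a small subnetwork are so small that they can be bridged by ramps with
few parameters. -/
lemma exists_rampSize_le {h d s k p : ℕ} {R : ℝ} (hR : 1 ≤ R) (hk : 0 < k) (hp : 20 * k * s ≤ p)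
    (hp0 : 0 < p) (A : Arch 1 (h + 1) d) (hA : A.FullyConnected) (hs : A.numParams ≤ s)
    {w : A.Params} (hw : w ∈ A.box (R * s / p))
    (h01 : ∀ z ∈ Set.Icc (0 : ℝ) 1, ∀ i, generator A w z i ∈ Set.Icc (0 : ℝ) 1) :
    ∃ n : ℕ, 0 < n ∧ rampSize d n h ≤ 8 * s ∧
      ∀ z ∈ Set.Icc (0 : ℝ) 1, ∀ j, 2 * k * |generator A w z j| ≤ R * n := by
  set r : ℝ := R * s / p with hr
  have hp0' : (0 : ℝ) < p := by exact_mod_cast hp0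
  have hR0 : 0 < R := by linarith
  have hr0 : 0 ≤ r := by positivity
  have hkr : 20 * k * r ≤ R := by
    have : (20 * k * s : ℝ) ≤ p := by exact_mod_cast hp
    rw [hr, ← mul_div_assoc, div_le_iff₀ hp0']
    nlinarith
  have hk1 : (1 : ℝ) ≤ k := by exact_mod_cast hk
  have hle1 : ∀ z ∈ Set.Icc (0 : ℝ) 1, ∀ j, |generator A w z j| ≤ 1 := fun z hz j => by
    rw [abs_of_nonneg (h01 z hz j).1]; exact (h01 z hz j).2
  have hx : ∀ z ∈ Set.Icc (0 : ℝ) 1, ∑ _j : Fin 1, |z| ≤ 1 := fun z hz => by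
    simpa [abs_of_nonneg hz.1] using hz.2
  have hcard := A.card_of_fullyConnected hA
  have hlen := A.length_hidden
  have hpos := A.hidden_pos
  have hext := A.abs_extend_le hr0 hw
  have hd := outputs_le_card_paramIdx d 1 A.hidden
  have hl := length_le_card_paramIdx d 1 hpos
  have hwid : ∀ n ∈ A.hidden, 2 * n ≤ s := fun n hn =>
    (two_mul_width_le_card_paramIdx d one_pos hpos hn).trans (hcard.le.trans hs)
  rcases h with _ | h
  · obtain ⟨n, hn⟩ := List.length_eq_one_iff.1 hlen
    have key : ∀ z ∈ Set.Icc (0 : ℝ) 1, ∀ j, |generator A w z j| ≤ r * (1 + n * (2 * r)) := by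
      intro z hz j
      rw [generator, Arch.fn_eq]
      generalize A.extend w = v at hext
      revert v
      rw [hn]
      intro v hv
      exact abs_netFun_singleton_le hr0 v hv (hx z hz) j
    rw [hn, card_paramIdx_cons, card_paramIdx_nil] at hcard
    have hn0 : 0 < n := hpos n (by simp [hn])
    have hn0' : (0 : ℝ) < n := by exact_mod_cast hn0
    -- With width `n` and one hidden layer, full connection means `2 n + d (n + 1) ≤ s`, which pays
    -- for `1 + 2 n` pairs joined to all `d` outputs. The jump is at most `r (1 + 2 n)` if `r ≤ 1`;
    -- otherwise it is at most 1 and `R ≥ 20 k`.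
    refine ⟨1 + 2 * n, by omega, ?_, fun z hz j => ?_⟩
    · rw [rampSize]
      nlinarith
    · push_cast
      rcases le_total r 1 with hr1 | hr1
      · have : |generator A w z j| ≤ r * (1 + 2 * n) := (key z hz j).trans
          (mul_le_mul_of_nonneg_left (by nlinarith) hr0)
        have h2 : 2 * k * r ≤ R := by nlinarith
        calc 2 * k * |generator A w z j| ≤ 2 * k * (r * (1 + 2 * n)) := by gcongr
          _ = 2 * k * r * (1 + 2 * n) := by ring
          _ ≤ R * (1 + 2 * n) := by gcongr
      · have := hle1 z hz j
        nlinarith [mul_nonneg hR0.le hn0'.le]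
  · have hs0 : 0 < s := by omega
    -- In deeper networks a pair costs 6 parameters regardless of `d`, and depth and `d` are at most
    -- `s`, so `s` pairs are affordable.
    refine ⟨s, hs0, ?_, fun z hz j => ?_⟩
    · rw [rampSize]
      omega
    -- If `s r ≤ 1`, hidden layers do not amplify and the values are at most `2 r`; otherwise the
    -- values, being in `[0,1]`, are at most `1 ≤ s r`.
    · rcases le_total (s * r) 1 with hsr | hsr
      · have key : |generator A w z j| ≤ 2 * r := by
          rw [generator, Arch.fn_eq]
          refine abs_netFun_le hr0 (fun n hn => ?_) _ hext (hx z hz) j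
          have : (2 * n : ℝ) ≤ s := by exact_mod_cast hwid n hn
          nlinarith
        have : (1 : ℝ) ≤ s := by exact_mod_cast hs0
        nlinarith
      · have := hle1 z hz j
        nlinarith

/-- Mixtures of small generators can be approximated by one generator. -/
lemma exists_concatenation {h d s k p : ℕ} {R : ℝ} (hR : 1 ≤ R) (hk : 0 < k)
    (hp : 20 * k * s ≤ p) (hp0 : 0 < p) (A : ℕ → Arch 1 (h + 1) d)
    (hA : ∀ i < k, (A i).FullyConnected) (hs : ∀ i < k, (A i).numParams ≤ s)
    (w : ∀ i, (A i).Params) (hw : ∀ i < k, w i ∈ (A i).box (R * s / p))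
    (hadm : ∀ i < k, (distributionClass (h + 1) d).admissible (A i) (w i)) :
    ∃ B : Arch 1 (h + 1) d, B.numParams ≤ p ∧ ∃ θ ∈ B.box R,
      ∀ i < k, ∀ z ∈ Set.Icc ((i : ℝ) / k) (i / k + (1 - (2 * R)⁻¹) / k),
        generator B θ z = generator (A i) (w i) ((z - i / k) / ((1 - (2 * R)⁻¹) / k)) := by
  set r : ℝ := R * s / p with hr
  have hp0' : (0 : ℝ) < p := by exact_mod_cast hp0
  have hR0 : 0 < R := by linarith
  have hr0 : 0 ≤ r := by positivity
  have hk0 : (0 : ℝ) < k := by exact_mod_cast hk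
  have hk1 : (1 : ℝ) ≤ k := by exact_mod_cast hk
  have hkr : 20 * k * r ≤ R := by
    have : (20 * k * s : ℝ) ≤ p := by exact_mod_cast hp
    rw [hr, ← mul_div_assoc, div_le_iff₀ hp0']
    nlinarith
  -- A slot of length `1 / k` consists of running time `ℓ` and transition time `δ`.
  set ℓ : ℝ := (1 - (2 * R)⁻¹) / k with hℓ
  set δ : ℝ := (2 * R)⁻¹ / k with hδ
  have hγ0 : 0 < (2 * R)⁻¹ := by positivity
  have hγ1 : (2 * R)⁻¹ ≤ 2⁻¹ := inv_anti₀ (by norm_num) (by linarith)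
  have hδ0 : 0 < δ := by positivity
  have hℓ0 : 0 < ℓ := div_pos (by norm_num at hγ1 ⊢; linarith) hk0
  have hℓδ : ℓ + δ = 1 / k := by rw [hℓ, hδ]; ring
  have hℓinv : ℓ⁻¹ ≤ 2 * k := by
    rw [inv_le_comm₀ hℓ0 (by positivity), hℓ, le_div_iff₀ hk0, mul_inv, mul_assoc,
      inv_mul_cancel₀ hk0.ne']
    linarith
  have hRδ : R * δ * (2 * k) = 1 := by rw [hδ]; field_simp
  -- The size is `18 s = 2 s + 2 * 8 s`: the accelerated curve and two ramps.
  have hex : ∀ i, ∃ X : (Fin 1 → ℝ) → Fin d → ℝ, i < k →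
      (Realizes relu R r (h + 1) 1 (18 * s) X ∧
      (∀ z ≤ (i : ℝ) / k - δ, (X fun _ => z) = 0) ∧
      (∀ z, (i : ℝ) / k + ℓ + δ ≤ z → (X fun _ => z) = 0) ∧
      ∀ z ∈ Set.Icc ((i : ℝ) / k) (i / k + ℓ),
        (X fun _ => z) = generator (A i) (w i) ((z - i / k) / ℓ)) := by
    intro i
    by_cases hi : i < k
    swap
    · exact ⟨0, fun h => absurd h hi⟩
    obtain ⟨h01, hz0, hz1⟩ := hadm i hi
    obtain ⟨n, hn, hns, hnb⟩ := exists_rampSize_le hR hk hp hp0 (A i) (hA i hi) (hs i hi) (hw i hi)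
      h01
    have hbd : ∀ z ∈ Set.Icc (0 : ℝ) 1, ∀ j,
        |(A i).fn relu (w i) (fun _ => z) j| ≤ R * δ * (R * n) := fun z hz j => by
      have := mul_le_mul_of_nonneg_left (hnb z hz j) (mul_pos hR0 hδ0).le
      rwa [← mul_assoc, hRδ, one_mul] at this
    obtain ⟨X, hX, hX'⟩ := Realizes.bump (t := (i : ℝ) / k) (δ := δ) (ℓ := ℓ) hR hr0 hδ0 hℓ0
      (by positivity)
      (by
        rw [add_assoc, hℓδ, ← add_div, div_le_one hk0]
        exact_mod_cast hi)
      (by nlinarith) ((A i).realizes relu hr0 (hw i hi)) hz0 hz1 hn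
      (hbd 0 (by simp)) (hbd 1 (by simp))
    have := hs i hi
    exact ⟨X, fun _ => ⟨hX.mono le_rfl le_rfl (by omega), hX'⟩⟩
  choose X hX using hex
  have hsum := Realizes.sum hR0.le fun i hi => (hX i hi).1
  -- The sum has size `18 k s ≤ p` and output biases at most `k r ≤ R`.
  obtain ⟨B, hB, θ, hθ, hBθ⟩ := (hsum.mono (p' := p) (β' := R) le_rfl (by nlinarith)
    (by nlinarith)).exists_arch
  refine ⟨B, hB, θ, hθ, fun i hi z hz => ?_⟩
  rw [generator, hBθ, Finset.sum_apply, Finset.sum_eq_single_of_mem i (Finset.mem_range.2 hi),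
    (hX i hi).2.2.2 z hz]
  -- Neighbouring bumps overlap only in the gaps, where the value of the sum is irrelevant; during
  -- the running time of curve `i` all others vanish.
  intro j hj hji
  have hjk := Finset.mem_range.1 hj
  rcases lt_or_gt_of_ne hji with hlt | hgt
  · refine (hX j hjk).2.2.1 z (le_trans ?_ hz.1)
    rw [add_assoc, hℓδ, ← add_div]
    gcongr
    exact_mod_cast hlt
  · refine (hX j hjk).2.1 z (hz.2.trans ?_)
    have : ((i : ℝ) + 1) / k ≤ j / k := by
      gcongr
      exact_mod_cast hgt
    rw [add_div, ← hℓδ] at this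
    linarith

/-! ### Uniform mixtures -/

/-- The uniform mixture of `f 0, …, f (k - 1)`. -/
noncomputable def mix {E : Type*} [AddCommMonoid E] [Module ℝ≥0 E] (k : ℕ) (f : ℕ → E) : E :=
  ∑ i ∈ Finset.range k, (k : ℝ≥0)⁻¹ • f i

lemma mix_succ {E : Type*} [AddCommMonoid E] [Module ℝ≥0 E] {k : ℕ} (hk : 0 < k) (f : ℕ → E) :
    mix (k + 1) f = ((k : ℝ≥0) / (k + 1)) • mix k f + ((k + 1 : ℝ≥0)⁻¹) • f k := by
  have hk' : (k : ℝ≥0) ≠ 0 := by exact_mod_cast hk.ne'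
  rw [mix, mix, Finset.sum_range_succ, Finset.smul_sum]
  push_cast
  congr 1
  refine Finset.sum_congr rfl fun i _ => ?_
  rw [smul_smul]
  congr 1
  field_simp

/-- Linearity is available only for two points of `C`, so the mixture is built up one member at a
time. -/
lemma mix_mem_and_map_mix {E : Type*} [AddCommMonoid E] [Module ℝ≥0 E] {C : Set E}
    (hC : Convex ℝ≥0 C) (Ψ : E → ℝ) (hΨ : ∀ f ∈ C, ∀ f' ∈ C, ∀ a b : ℝ≥0, a + b = 1 →
      Ψ (a • f + b • f') = a * Ψ f + b * Ψ f') {k : ℕ} (hk : 0 < k) (f : ℕ → E)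
    (hf : ∀ i, f i ∈ C) : mix k f ∈ C ∧ k * Ψ (mix k f) = ∑ i ∈ Finset.range k, Ψ (f i) := by
  induction k, hk using Nat.le_induction with
  | base => simp [mix, hf]
  | succ k hk ih =>
    have hab : (k : ℝ≥0) / (k + 1) + (k + 1 : ℝ≥0)⁻¹ = 1 := by field_simp
    rw [mix_succ hk, hΨ _ ih.1 _ (hf k) _ _ hab, Finset.sum_range_succ, ← ih.2]
    refine ⟨hC ih.1 (hf k) zero_le zero_le hab, ?_⟩
    push_cast
    field_simp

/-! ### Total variation -/

lemma continuous_netFun (d : ℕ) (m : ℕ) (ns : List ℕ) (w : ParamIdx d m ns → ℝ) :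
    Continuous (netFun relu d m ns w) := by
  have haff : ∀ (m n : ℕ) (w : LayerIdx m n → ℝ), Continuous (affineLayer w) := fun m n w => by
    unfold affineLayer
    fun_prop
  induction ns generalizing m with
  | nil => exact haff m d w
  | cons n ns ih =>
    exact (ih n _).comp (continuous_pi fun i =>
      continuous_relu.comp ((continuous_apply i).comp (haff m n fun e => w (Sum.inl e))))

lemma continuous_generator {h d : ℕ} (A : Arch 1 h d) (w : A.Params) :
    Continuous (generator A w) := by
  unfold generator
  rw [Arch.fn_eq]
  exact (continuous_netFun _ _ _ _).comp (continuous_pi fun _ => continuous_id)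

instance isProbabilityMeasure_unitInterval :
    IsProbabilityMeasure ((volume : Measure ℝ).restrict (Set.Icc (0 : ℝ) 1)) :=
  ⟨by simp⟩

lemma isProbabilityMeasure_model {h d : ℕ} (A : Arch 1 h d) (w : A.Params) :
    IsProbabilityMeasure ((distributionClass h d).model A w) :=
  Measure.isProbabilityMeasure_map (continuous_generator A w).measurable.aemeasurable

/-- The one-sided bound for the complement of `S` is the other bound for `S`. -/
lemma tvDist_le {X : Type*} [MeasurableSpace X] {μ ν : Measure X} [IsProbabilityMeasure μ]
    [IsProbabilityMeasure ν] {γ : ℝ} (h : ∀ S, MeasurableSet S → ν.real S - γ ≤ μ.real S) :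
    tvDist μ ν ≤ γ := by
  have : Nonempty {S : Set X // MeasurableSet S} := ⟨⟨∅, MeasurableSet.empty⟩⟩
  refine ciSup_le fun S => abs_le.2 ⟨?_, ?_⟩
  · linarith [h S.1 S.2]
  · have := h _ S.2.compl
    rw [probReal_compl_eq_one_sub S.2, probReal_compl_eq_one_sub S.2] at this
    linarith

lemma real_mix {X : Type*} [MeasurableSpace X] (k : ℕ) (ν : ℕ → Measure X)
    [∀ i, IsFiniteMeasure (ν i)] (S : Set X) :
    (mix k ν).real S = ∑ i ∈ Finset.range k, (k : ℝ)⁻¹ * (ν i).real S := by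
  rw [mix, measureReal_def, Measure.finsetSum_apply, ENNReal.toReal_sum]
  · refine Finset.sum_congr rfl fun i _ => ?_
    rw [Measure.smul_apply, ENNReal.smul_def, smul_eq_mul, ENNReal.toReal_mul, measureReal_def]
    simp
  · intro i _
    rw [Measure.smul_apply, ENNReal.smul_def, smul_eq_mul]
    exact ENNReal.mul_ne_top ENNReal.coe_ne_top (measure_ne_top _ _)

lemma isProbabilityMeasure_mix {X : Type*} [MeasurableSpace X] {k : ℕ} (hk : 0 < k)
    (ν : ℕ → Measure X) [∀ i, IsProbabilityMeasure (ν i)] : IsProbabilityMeasure (mix k ν) := by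
  have hk' : (k : ℝ) ≠ 0 := by exact_mod_cast hk.ne'
  have h := real_mix k ν Set.univ
  simp only [probReal_univ, mul_one, Finset.sum_const, Finset.card_range, nsmul_eq_mul,
    mul_inv_cancel₀ hk'] at h
  rw [measureReal_def, ENNReal.toReal_eq_one_iff] at h
  exact ⟨h⟩

/-- A curve that runs through several curves one after the other, in disjoint time intervals of the
same length `ℓ`, has nearly the law of the mixture. -/
lemma tvDist_map_mix_le {X : Type*} [MeasurableSpace X] {k : ℕ} (hk : 0 < k) {ℓ : ℝ} (hℓ : 0 < ℓ)
    (hkℓ : k * ℓ < 1) {g : ℝ → X} (hg : Measurable g) {G : ℕ → ℝ → X}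
    (hG : ∀ i, Measurable (G i))
    (hgG : ∀ i < k, ∀ z ∈ Set.Icc ((i : ℝ) / k) (i / k + ℓ), g z = G i ((z - i / k) / ℓ)) :
    tvDist ((volume.restrict (Set.Icc (0 : ℝ) 1)).map g)
      (mix k fun i => (volume.restrict (Set.Icc (0 : ℝ) 1)).map (G i)) ≤ 1 - k * ℓ := by
  have hk0 : (0 : ℝ) < k := by exact_mod_cast hk
  have := Measure.isProbabilityMeasure_map
    (μ := volume.restrict (Set.Icc (0 : ℝ) 1)) hg.aemeasurable
  have : ∀ i, IsProbabilityMeasure ((volume.restrict (Set.Icc (0 : ℝ) 1)).map (G i)) := fun i =>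
    Measure.isProbabilityMeasure_map (hG i).aemeasurable
  have := isProbabilityMeasure_mix hk
    fun i => (volume.restrict (Set.Icc (0 : ℝ) 1)).map (G i)
  refine tvDist_le fun S hS => ?_
  have hreal : ∀ f : ℝ → X, Measurable f →
      ((volume.restrict (Set.Icc (0 : ℝ) 1)).map f).real S =
        volume.real (f ⁻¹' S ∩ Set.Icc (0 : ℝ) 1) := fun f hf => by
    rw [map_measureReal_apply hf hS, measureReal_restrict_apply (hf hS)]
  -- `B i` is the set of times in slot `i` at which the accelerated `i`-th curve is in `S`. These
  -- sets are disjoint, the strict inequality `k * ℓ < 1` separating the closed intervals, and they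
  -- have total measure `k ℓ` times the mass of `S` under the mixture.
  set B : ℕ → Set ℝ := fun i => (fun z => (z - i / k) * ℓ⁻¹) ⁻¹' (G i ⁻¹' S ∩ Set.Icc (0 : ℝ) 1)
    with hB
  have hBmeas : ∀ i, MeasurableSet (B i) := fun i =>
    (measurable_id.sub_const _ |>.mul_const _) ((hG i hS).inter measurableSet_Icc)
  have hBvol : ∀ i, volume.real (B i) = ℓ * volume.real (G i ⁻¹' S ∩ Set.Icc (0 : ℝ) 1) := fun i => by
    have h1 : B i = (fun z : ℝ => z + -(i / k)) ⁻¹'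
        ((fun z : ℝ => z * ℓ⁻¹) ⁻¹' (G i ⁻¹' S ∩ Set.Icc (0 : ℝ) 1)) := by
      ext z; simp [hB, sub_eq_add_neg]
    rw [h1, measureReal_def, measure_preimage_add_right,
      Real.volume_preimage_mul_right (inv_ne_zero hℓ.ne'), ENNReal.toReal_mul, inv_inv,
      abs_of_pos hℓ, ENNReal.toReal_ofReal hℓ.le, measureReal_def]
  have hBIcc : ∀ i, ∀ z ∈ B i, z ∈ Set.Icc ((i : ℝ) / k) (i / k + ℓ) := by
    rintro i z ⟨-, h0, h1⟩
    have h0' : 0 ≤ z - i / k := by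
      by_contra! hlt
      exact absurd h0 (not_le.2 (mul_neg_of_neg_of_pos hlt (inv_pos.2 hℓ)))
    have h1' : (z - i / k) * ℓ⁻¹ ≤ 1 := h1
    rw [← div_eq_mul_inv, div_le_one hℓ] at h1'
    exact ⟨by linarith, by linarith⟩
  have hℓk : ℓ < 1 / k := by rw [lt_div_iff₀ hk0]; linarith
  have hdisj : Set.PairwiseDisjoint (↑(Finset.range k)) B := by
    have : ∀ i j : ℕ, i < j → Disjoint (B i) (B j) := fun i j hij => by
      refine Set.disjoint_left.2 fun z hz hz' => ?_
      have h1 := (hBIcc i z hz).2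
      have h2 := (hBIcc j z hz').1
      have h3 : ((i : ℝ) + 1) / k ≤ j / k := by
        gcongr
        exact_mod_cast hij
      rw [add_div] at h3
      linarith
    intro i _ j _ hij
    rcases lt_or_gt_of_ne hij with hij | hij
    · exact this i j hij
    · exact (this j i hij).symm
  have hsub : (⋃ i ∈ Finset.range k, B i) ⊆ g ⁻¹' S ∩ Set.Icc (0 : ℝ) 1 := by
    intro z hz
    simp only [Set.mem_iUnion, Finset.mem_range] at hz
    obtain ⟨i, hi, hz⟩ := hz
    have hzI := hBIcc i z hz
    have hik : ((i : ℝ) + 1) / k ≤ 1 := by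
      rw [div_le_one hk0]
      exact_mod_cast hi
    rw [add_div] at hik
    refine ⟨?_, le_trans (by positivity) hzI.1, by linarith [hzI.2]⟩
    have : G i ((z - i / k) * ℓ⁻¹) ∈ S := hz.1
    rw [← div_eq_mul_inv] at this
    change g z ∈ S
    rw [hgG i hi z hzI]
    exact this
  have hle : ∑ i ∈ Finset.range k, volume.real (B i) ≤ volume.real (g ⁻¹' S ∩ Set.Icc (0 : ℝ) 1) := by
    have hfin : volume (g ⁻¹' S ∩ Set.Icc (0 : ℝ) 1) ≠ ⊤ :=
      ((measure_mono Set.inter_subset_right).trans_lt (by simp)).ne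
    rw [← measureReal_biUnion_finset hdisj (fun i _ => hBmeas i) fun i hi =>
      ((measure_mono ((Set.subset_biUnion_of_mem (u := B) hi).trans hsub)).trans_lt
        hfin.lt_top).ne]
    exact measureReal_mono hsub hfin
  have hmix := real_mix k (fun i => (volume.restrict (Set.Icc (0 : ℝ) 1)).map (G i)) S
  have hmix1 : (mix k fun i => (volume.restrict (Set.Icc (0 : ℝ) 1)).map (G i)).real S ≤ 1 :=
    measureReal_le_one
  rw [hreal g hg]
  simp only [hBvol, ← Finset.mul_sum] at hle
  simp only [hreal _ (hG _), ← Finset.mul_sum] at hmix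
  rw [eq_inv_mul_iff_mul_eq₀ hk0.ne'] at hmix
  rw [← hmix] at hle
  nlinarith

/-! ### Zero networks -/

/-- An architecture without parameters. -/
def emptyArch (m h d : ℕ) : Arch m h d where
  hidden := List.replicate h 1
  length_hidden := List.length_replicate
  hidden_pos n hn := by simp [List.eq_of_mem_replicate hn]
  conn := ∅

lemma numParams_emptyArch (m h d : ℕ) : (emptyArch m h d).numParams = 0 := Finset.card_empty

lemma Arch.zero_mem_box {m h d : ℕ} (A : Arch m h d) {R : ℝ} (hR : 0 ≤ R) : (0 : A.Params) ∈ A.box R :=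
  fun _ => by simpa using hR

/-! ### Replication of mixtures by a single network -/

/-- The models represented by the admissible fully connected networks with at most `s` parameters
bounded by `r`. -/
def ModelClass.submodels {E : Type} (M : ModelClass E) (s : ℕ) (r : ℝ) : Set E :=
  {f | ∃ S : Arch M.inputs M.hiddenLayers M.outputs, S.FullyConnected ∧ S.numParams ≤ s ∧
    ∃ w ∈ S.box r, M.admissible S w ∧ f = M.model S w}

lemma box_mono {m h d : ℕ} {A : Arch m h d} {r R : ℝ} (hr : r ≤ R) {w : A.Params}
    (hw : w ∈ A.box r) : w ∈ A.box R := fun i => (hw i).trans hr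

lemma exists_model_eq_mix {σ : ℝ → ℝ} {m h d s k p : ℕ} {R : ℝ} (hR : 0 ≤ R) (hk : 0 < k)
    (hp : k * s ≤ p) {f : ℕ → (Fin m → ℝ) → Fin d → ℝ}
    (hf : ∀ i, f i ∈ (functionClass σ m h d).submodels s R) :
    ∃ A : Arch m h d, A.numParams ≤ p ∧ ∃ w ∈ A.box R,
      (functionClass σ m h d).model A w = mix k f := by
  have hr : ∀ i < k, Realizes σ R R h m s (f i) := fun i _ => by
    obtain ⟨S, -, hS, w, hw, -, hfw⟩ := hf i
    rw [hfw]
    exact (Arch.realizes S σ hR hw).mono le_rfl le_rfl hS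
  obtain ⟨A, hA, w, hw, hAw⟩ := (Realizes.average hR hk hr).exists_arch
  refine ⟨A, hA.trans hp, w, hw, hAw.trans ?_⟩
  rw [mix]
  refine Finset.sum_congr rfl fun i _ => ?_
  funext x j
  simp [NNReal.smul_def]

lemma exists_tvDist_mix_le {h d s k p : ℕ} {R : ℝ} (hh : 1 ≤ h) (hR : 0 < R) (hk : 0 < k)
    (hp0 : 0 < p) (hp : 20 * k * s ≤ p) {q : ℕ → Measure (Fin d → ℝ)}
    (hq : ∀ i, q i ∈ (distributionClass h d).submodels s (R * s / p)) :
    ∃ A : Arch 1 h d, A.numParams ≤ p ∧ ∃ w ∈ A.box R,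
      tvDist ((distributionClass h d).model A w) (mix k q) ≤ 1 / R := by
  obtain ⟨h, rfl⟩ : ∃ h', h = h' + 1 := ⟨h - 1, by omega⟩
  choose S hS hSs w hw hadm hqw using hq
  have : ∀ i, IsProbabilityMeasure (q i) := fun i => by
    rw [hqw i]; exact isProbabilityMeasure_model (S i) (w i)
  have := isProbabilityMeasure_mix hk q
  -- For `R ≤ 1` the claimed bound is at least 1, so any network will do.
  rcases le_total R 1 with hR1 | hR1
  · refine ⟨emptyArch 1 (h + 1) d, by simp [numParams_emptyArch], 0, Arch.zero_mem_box _ hR.le, ?_⟩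
    have := isProbabilityMeasure_model (emptyArch 1 (h + 1) d) 0
    refine (tvDist_le (γ := 1) fun T _ => ?_).trans ((one_le_div hR).2 hR1)
    have h1 : (mix k q).real T ≤ 1 := measureReal_le_one
    exact (sub_nonpos.2 h1).trans measureReal_nonneg
  · obtain ⟨B, hB, θ, hθ, hBθ⟩ := exists_concatenation hR1 hk hp hp0 S (fun i _ => hS i)
      (fun i _ => hSs i) w (fun i _ => hw i) (fun i _ => hadm i)
    refine ⟨B, hB, θ, hθ, ?_⟩
    have hk0 : (0 : ℝ) < k := by exact_mod_cast hk
    have hγ0 : 0 < (2 * R)⁻¹ := by positivity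
    have hγ1 : (2 * R)⁻¹ ≤ 2⁻¹ := inv_anti₀ (by norm_num) (by linarith)
    have hγ2 : (2 * R)⁻¹ ≤ 1 / R := by rw [one_div]; exact inv_anti₀ hR (by linarith)
    have hkℓ : k * ((1 - (2 * R)⁻¹) / k) = 1 - (2 * R)⁻¹ := mul_div_cancel₀ _ hk0.ne'
    have := tvDist_map_mix_le hk (ℓ := (1 - (2 * R)⁻¹) / k)
      (div_pos (by norm_num at hγ1 ⊢; linarith) hk0) (by rw [hkℓ]; linarith)
      (continuous_generator B θ).measurable
      (fun i => (continuous_generator (S i) (w i)).measurable) hBθ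
    rw [hkℓ, sub_sub_cancel] at this
    rw [show q = fun i => (volume.restrict (Set.Icc (0 : ℝ) 1)).map (generator (S i) (w i)) from
      funext hqw]
    exact this.trans hγ2

/-! ### Discretization of the parameters -/

/-- The fully connected networks with at most `s` parameters bounded by `r`. -/
structure SmallNet (m h d s : ℕ) (r : ℝ) where
  arch : Arch m h d
  params : arch.Params
  fullyConnected : arch.FullyConnected
  numParams_le : arch.numParams ≤ s
  mem_box : params ∈ arch.box r

/-- The widths of the hidden layers, as a composition. -/
def widthsComposition {m h d s : ℕ} (A : Arch m h d) (hA : A.FullyConnected)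
    (hs : A.numParams ≤ s) : Composition (s + 1) where
  -- The last block fills up the sum; it is positive because every hidden unit has its own bias, so
  -- the widths add up to at most `s`.
  blocks := A.hidden ++ [s + 1 - A.hidden.sum]
  blocks_pos := by
    have h1 := sum_le_card_paramIdx d m A.hidden
    rw [A.card_of_fullyConnected hA] at h1
    intro i hi
    rcases List.mem_append.1 hi with hi | hi
    · exact A.hidden_pos i hi
    · rw [List.mem_singleton.1 hi]
      omega
  blocks_sum := by
    have h1 := sum_le_card_paramIdx d m A.hidden
    rw [A.card_of_fullyConnected hA] at h1
    rw [List.sum_append, List.sum_singleton]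
    omega

lemma Arch.eq_of_hidden_eq {m h d : ℕ} {A B : Arch m h d} (hA : A.FullyConnected)
    (hB : B.FullyConnected) (h : A.hidden = B.hidden) : A = B := by
  obtain ⟨ns, hl, hpos, conn⟩ := A
  obtain ⟨ns', hl', hpos', conn'⟩ := B
  obtain rfl : ns = ns' := h
  have h1 : conn = Finset.univ := hA
  have h2 : conn' = Finset.univ := hB
  rw [h1, h2]

lemma abs_sub_le_of_floor_eq {a b r η : ℝ} (hη : 0 < η) (ha : |a| ≤ r) (hb : |b| ≤ r)
    (h : ⌊(a + r) / η⌋₊ = ⌊(b + r) / η⌋₊) : |a - b| ≤ η := by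
  have ha0 : 0 ≤ (a + r) / η := div_nonneg (by linarith [(abs_le.1 ha).1]) hη.le
  have hb0 : 0 ≤ (b + r) / η := div_nonneg (by linarith [(abs_le.1 hb).1]) hη.le
  have a1 := Nat.floor_le ha0
  have a2 := Nat.lt_floor_add_one ((a + r) / η)
  have b1 := Nat.floor_le hb0
  have b2 := Nat.lt_floor_add_one ((b + r) / η)
  rw [h] at a1 a2
  have e : (a + r) / η - (b + r) / η = (a - b) / η := by ring
  refine abs_le.2 ⟨?_, ?_⟩
  · have : -1 ≤ (a - b) / η := by linarith
    rw [le_div_iff₀ hη] at this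
    linarith
  · have : (a - b) / η ≤ 1 := by linarith
    rw [div_le_iff₀ hη] at this
    linarith

lemma Arch.norm_le_of_abs_le {m h d s : ℕ} {A : Arch m h d} (hs : A.numParams ≤ s) {η : ℝ}
    (hη : 0 ≤ η) (v : A.Params) (hv : ∀ i, |v i| ≤ η) : ‖v‖ ≤ √s * η := by
  rw [EuclideanSpace.norm_eq]
  refine Real.sqrt_le_iff.2 ⟨by positivity, ?_⟩
  rw [mul_pow, Real.sq_sqrt (Nat.cast_nonneg _)]
  calc ∑ i, ‖v i‖ ^ 2 ≤ ∑ _i : A.conn, η ^ 2 :=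
        Finset.sum_le_sum fun i _ => pow_le_pow_left₀ (norm_nonneg _) (hv i) 2
    _ = A.numParams * η ^ 2 := by simp [Arch.numParams]
    _ ≤ s * η ^ 2 := by gcongr

/-- The networks with at most `s` parameters can be discretized at scale `η` with few classes. -/
lemma exists_code (m h d s : ℕ) {r η : ℝ} (hη : 0 < η) :
    ∃ code : SmallNet m h d s r → Composition (s + 1) × (Fin s → Fin (⌊2 * r / η⌋₊ + 1)),
      ∀ (A : Arch m h d) (w : A.Params) (h₁ : A.FullyConnected) (h₂ : A.numParams ≤ s)
        (h₃ : w ∈ A.box r), ∀ y : SmallNet m h d s r, code ⟨A, w, h₁, h₂, h₃⟩ = code y →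
        ∃ (v : A.Params) (h₄ : v ∈ A.box r), y = ⟨A, v, h₁, h₂, h₄⟩ ∧ ‖w - v‖ ≤ √s * η := by
  have bucket : ∀ {a : ℝ}, |a| ≤ r → ⌊(a + r) / η⌋₊ < ⌊2 * r / η⌋₊ + 1 := fun {a} ha =>
    Nat.lt_succ_of_le (Nat.floor_le_floor
      (div_le_div_of_nonneg_right (by linarith [(abs_le.1 ha).2]) hη.le))
  refine ⟨fun x => (widthsComposition x.arch x.fullyConnected x.numParams_le, fun j =>
    if hj : (j : ℕ) < x.arch.numParams then
      ⟨⌊(x.params (x.arch.conn.equivFin.symm ⟨j, hj⟩) + r) / η⌋₊, bucket (x.mem_box _)⟩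
    else 0), ?_⟩
  rintro A w h₁ h₂ h₃ ⟨B, v, g₁, g₂, g₃⟩ hxy
  rw [Prod.mk.injEq] at hxy
  obtain ⟨hc, hp⟩ := hxy
  have hAB : A = B := by
    refine Arch.eq_of_hidden_eq h₁ g₁ ?_
    have := congrArg Composition.blocks hc
    simp only [widthsComposition] at this
    exact (List.append_inj' this rfl).1
  subst hAB
  refine ⟨v, g₃, rfl, A.norm_le_of_abs_le h₂ hη.le _ fun i => ?_⟩
  have hlt := (A.conn.equivFin i).2
  have := congrFun hp ⟨A.conn.equivFin i, hlt.trans_le h₂⟩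
  have hlt' : (A.conn.equivFin i : ℕ) < A.numParams := hlt
  have e : A.conn.equivFin.symm ⟨A.conn.equivFin i, hlt'⟩ = i :=
    A.conn.equivFin.symm_apply_apply i
  simp only [hlt', dif_pos, Fin.mk.injEq, e] at this
  exact abs_sub_le_of_floor_eq hη (h₃ i) (g₃ i) this

lemma ModelClass.exists_net {E : Type} (M : ModelClass E) (s : ℕ) {r η : ℝ} (hη : 0 < η) :
    ∃ (I : Type) (_ : Fintype I) (F : I → E), Fintype.card I ≤ 2 ^ s * (⌊2 * r / η⌋₊ + 1) ^ s ∧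
      (∀ i, F i ∈ M.submodels s r) ∧
      ∀ A : Arch M.inputs M.hiddenLayers M.outputs, A.FullyConnected → A.numParams ≤ s →
        ∀ w ∈ A.box r, M.admissible A w →
          ∃ i, ∃ v ∈ A.box r, F i = M.model A v ∧ ‖w - v‖ ≤ √s * η := by
  classical
  obtain ⟨code, hcode⟩ := exists_code M.inputs M.hiddenLayers M.outputs s (r := r) hη
  let C := Composition (s + 1) × (Fin s → Fin (⌊2 * r / η⌋₊ + 1))
  -- Representatives are chosen among the admissible networks of each class, so the net consists of
  -- submodels even where rounding would destroy admissibility.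
  have hrep : ∀ i : {c : C // ∃ x, M.admissible x.arch x.params ∧ code x = c}, ∃ x,
      M.admissible x.arch x.params ∧ code x = i.1 := fun i => i.2
  choose x hxa hxc using hrep
  refine ⟨{c : C // ∃ x, M.admissible x.arch x.params ∧ code x = c}, inferInstance,
    fun i => M.model (x i).arch (x i).params, ?_, fun i => ⟨(x i).arch, (x i).fullyConnected,
      (x i).numParams_le, (x i).params, (x i).mem_box, hxa i, rfl⟩, fun A h₁ h₂ w h₃ hadm => ?_⟩
  · refine (Fintype.card_subtype_le _).trans (le_of_eq ?_)
    rw [Fintype.card_prod, composition_card, Fintype.card_fun, Fintype.card_fin,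
      Fintype.card_fin, Nat.add_sub_cancel]
  · let i : {c : C // ∃ x, M.admissible x.arch x.params ∧ code x = c} :=
      ⟨code ⟨A, w, h₁, h₂, h₃⟩, ⟨A, w, h₁, h₂, h₃⟩, hadm, rfl⟩
    obtain ⟨v, hv, hxv, hwv⟩ := hcode A w h₁ h₂ h₃ (x i) (hxc i).symm
    exact ⟨i, v, hv, by beta_reduce; rw [hxv], hwv⟩

/-! ### Sizes -/

/-- There is room for mixtures of about `256 (D / ε)² s l` subnetworks of size `s`. -/
lemma mul_mixture_size_le {s p k : ℕ} {ε D l : ℝ} (hε : 0 < ε) (hD : 0 < D) (hεD : ε ≤ 2 * D)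
    (hl : Real.log 2 ≤ l) (hs : 0 < s) (hsp : (s : ℝ) ≤ 1 / 100 * (ε / D) * √(p / l))
    (hk : (k : ℝ) ≤ 256 * (D / ε) ^ 2 * s * l + 1) : 20 * k * s ≤ p := by
  have hl0 : 0 < l := (Real.log_pos one_lt_two).trans_le hl
  have hl2 : 0.69 ≤ l := by have := Real.log_two_gt_d9; linarith
  have hs1 : (1 : ℝ) ≤ s := by exact_mod_cast hs
  have h1 : (s : ℝ) ^ 2 ≤ (1 / 100 * (ε / D)) ^ 2 * (p / l) := by
    calc (s : ℝ) ^ 2 ≤ (1 / 100 * (ε / D) * √(p / l)) ^ 2 := by gcongr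
      _ = _ := by rw [mul_pow, Real.sq_sqrt (by positivity)]
  have h2 : 10000 * ((D / ε) ^ 2 * (s : ℝ) ^ 2 * l) ≤ p := by
    calc 10000 * ((D / ε) ^ 2 * (s : ℝ) ^ 2 * l)
        ≤ 10000 * ((D / ε) ^ 2 * ((1 / 100 * (ε / D)) ^ 2 * (p / l)) * l) := by gcongr
      _ = (p : ℝ) := by field_simp; norm_num
  have h3 : 1 / 4 ≤ (D / ε) ^ 2 := by
    have : 1 / 2 ≤ D / ε := by rw [le_div_iff₀ hε]; linarith
    nlinarith
  -- This absorbs the rounding up of `k`; altogether `20 * (256 + 6) ≤ 10000`.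
  have h4 : (s : ℝ) ≤ 6 * ((D / ε) ^ 2 * s ^ 2 * l) := by
    have a1 : (s : ℝ) ≤ s ^ 2 := by nlinarith
    have a2 : 1 / 4 * 0.69 ≤ (D / ε) ^ 2 * l := by gcongr
    nlinarith [mul_le_mul_of_nonneg_right a2 (sq_nonneg (s : ℝ))]
  have h5 : (20 * k * s : ℝ) ≤ p := by
    nlinarith [mul_le_mul_of_nonneg_right hk (by positivity : (0 : ℝ) ≤ s)]
  exact_mod_cast h5

/-- For `Λ ≥ 2` the number of choices per parameter is at most `2 (2 Λ + 1) ≤ 8 Λ ≤ Λ ^ 4`. -/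
lemma log_card_net_le {s N : ℕ} {Λ x : ℝ} (hΛ : 2 ≤ Λ) (hx0 : 0 ≤ x) (hx : x ≤ 2 * Λ)
    (hN0 : 0 < N) (hN : N ≤ 2 ^ s * (⌊x⌋₊ + 1) ^ s) : Real.log N ≤ 4 * s * Real.log Λ := by
  have h1 : (N : ℝ) ≤ (Λ ^ 4) ^ s := by
    calc (N : ℝ) ≤ 2 ^ s * (⌊x⌋₊ + 1) ^ s := by exact_mod_cast hN
      _ = (2 * (⌊x⌋₊ + 1)) ^ s := by rw [mul_pow]
      _ ≤ (Λ ^ 4) ^ s := by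
        gcongr
        have := Nat.floor_le hx0
        have h3 : 8 ≤ Λ ^ 3 := by
          calc (8 : ℝ) = 2 ^ 3 := by norm_num
            _ ≤ Λ ^ 3 := by gcongr
        nlinarith
  have h2 := Real.log_le_log (by exact_mod_cast hN0) h1
  rw [Real.log_pow, Real.log_pow] at h2
  push_cast at h2
  linarith

/-! ### Equilibria -/

lemma ModelClass.submodels_subset_models {E : Type} (M : ModelClass E) {s p : ℕ} {r R : ℝ} (hs : s ≤ p)
    (hr : r ≤ R) : M.submodels s r ⊆ M.models p R := by
  rintro f ⟨S, -, hS, w, hw, -, rfl⟩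
  exact ⟨S, hS.trans hs, w, box_mono hr hw, rfl⟩

section Equilibrium

variable {E F : Type} [AddCommMonoid E] [Module ℝ≥0 E] [AddCommMonoid F] [Module ℝ≥0 F]
  {M₁ : ModelClass E} {M₂ : ModelClass F} {Φ : E → F → ℝ} {p : ℕ} {R L D : ℝ}

lemma ModelClass.models_subset_hull (M : ModelClass E) (p : ℕ) (R : ℝ) :
    M.models p R ⊆ M.hull p R := subset_convexHull _ _

lemma IsGame.mix_left (hΦ : IsGame M₁ M₂ Φ p R L D) {k : ℕ} (hk : 0 < k) {f : ℕ → E}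
    (hf : ∀ i, f i ∈ M₁.hull p R) {q : F} (hq : q ∈ M₂.hull p R) :
    mix k f ∈ M₁.hull p R ∧ k * Φ (mix k f) q = ∑ i ∈ Finset.range k, Φ (f i) q :=
  mix_mem_and_map_mix (convex_convexHull _ _) (fun g => Φ g q)
    (fun f hf f' hf' a b hab => hΦ.linear_left f hf f' hf' q hq a b hab) hk f hf

lemma IsGame.mix_right (hΦ : IsGame M₁ M₂ Φ p R L D) {k : ℕ} (hk : 0 < k) {f : E}
    (hf : f ∈ M₁.hull p R) {q : ℕ → F} (hq : ∀ i, q i ∈ M₂.hull p R) :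
    mix k q ∈ M₂.hull p R ∧ k * Φ f (mix k q) = ∑ i ∈ Finset.range k, Φ f (q i) :=
  mix_mem_and_map_mix (convex_convexHull _ _) (Φ f)
    (fun q hq q' hq' a b hab => hΦ.linear_right f hf q hq q' hq' a b hab) hk q hq

lemma IsGame.lipschitz_left (hΦ : IsGame M₁ M₂ Φ p R L D)
    {A : Arch M₁.inputs M₁.hiddenLayers M₁.outputs} (hA : A.numParams ≤ p) {w w' : A.Params}
    (hw : w ∈ A.box R) (hw' : w' ∈ A.box R) {q : F} (hq : q ∈ M₂.models p R) :
    Φ (M₁.model A w) q ≤ Φ (M₁.model A w') q + L * ‖w - w'‖ := by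
  obtain ⟨B, hB, θ, hθ, rfl⟩ := hq
  have := (abs_le.1 (hΦ.lipschitz A hA B hB w hw w' hw' θ hθ θ hθ)).2
  simp only [sub_self, norm_zero, ne_eq, OfNat.ofNat_ne_zero, not_false_eq_true, zero_pow,
    add_zero, Real.sqrt_sq (norm_nonneg _)] at this
  linarith

lemma IsGame.lipschitz_right (hΦ : IsGame M₁ M₂ Φ p R L D) {f : E} (hf : f ∈ M₁.models p R)
    {B : Arch M₂.inputs M₂.hiddenLayers M₂.outputs} (hB : B.numParams ≤ p) {θ θ' : B.Params}
    (hθ : θ ∈ B.box R) (hθ' : θ' ∈ B.box R) :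
    Φ f (M₂.model B θ') ≤ Φ f (M₂.model B θ) + L * ‖θ - θ'‖ := by
  obtain ⟨A, hA, w, hw, rfl⟩ := hf
  have := (abs_le.1 (hΦ.lipschitz A hA B hB w hw w hw θ hθ θ' hθ')).1
  simp only [sub_self, norm_zero, ne_eq, OfNat.ofNat_ne_zero, not_false_eq_true, zero_pow,
    zero_add, Real.sqrt_sq (norm_nonneg _)] at this
  linarith

/-- The trivial cases: the payoff is almost constant. -/
lemma equilibrium_of_small (hΦ : IsGame M₁ M₂ Φ p R L D) (hR : 0 ≤ R) (hL : 0 ≤ L) {s : ℕ}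
    {r ε : ℝ} (hs : s ≤ p) (hr0 : 0 ≤ r) (hr : r ≤ R) (h₁ : ∀ A B, M₁.model A 0 = M₁.model B 0)
    (h₂ : ∀ A B, M₂.model A 0 = M₂.model B 0)
    (hε : 2 * D ≤ ε ∨ 2 * (L * (√s * r)) ≤ ε) :
    HasLimitedCapacityEquilibrium M₁ M₂ Φ p R s r ε := by
  refine ⟨emptyArch _ _ _, by simp [numParams_emptyArch], emptyArch _ _ _,
    by simp [numParams_emptyArch], 0, Arch.zero_mem_box _ hR, 0, Arch.zero_mem_box _ hR, ?_⟩
  intro S _ hS T _ hT w hw _ θ hθ _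
  have hw' := box_mono hr hw
  have hθ' := box_mono hr hθ
  have z₁ := S.zero_mem_box hR
  have z₂ := T.zero_mem_box hR
  -- The zero vector represents the same model in every architecture. This permits a comparison
  -- within `S` and within `T`, where the Lipschitz condition applies.
  rw [h₁ (emptyArch _ _ _) S, h₂ (emptyArch _ _ _) T]
  rcases hε with hε | hε
  · have b₁ := hΦ.bounded S (hS.trans hs) T (hT.trans hs) w hw' 0 z₂
    have b₂ := hΦ.bounded S (hS.trans hs) T (hT.trans hs) 0 z₁ θ hθ'
    linarith [(abs_le.1 b₁).2, (abs_le.1 b₂).1]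
  · have b₁ := hΦ.lipschitz_left (hS.trans hs) hw' z₁ ⟨T, hT.trans hs, 0, z₂, rfl⟩
    have b₂ := hΦ.lipschitz_right ⟨S, hS.trans hs, 0, z₁, rfl⟩ (hT.trans hs) hθ' z₂
    rw [sub_zero] at b₁ b₂
    have c₁ := mul_le_mul_of_nonneg_left (S.norm_le_of_abs_le hS hr0 w hw) hL
    have c₂ := mul_le_mul_of_nonneg_left (T.norm_le_of_abs_le hT hr0 θ hθ) hL
    linarith

/-- A game has a limited-capacity equilibrium if both players can imitate uniform mixtures of small
networks by one network. -/
lemma equilibrium_of_imitation (hΦ : IsGame M₁ M₂ Φ p R L D) (hR : 0 < R) (hL : 0 < L)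
    (hD : 0 < D) {s : ℕ} {r ε e₁ e₂ : ℝ} (hε : 0 < ε) (hs : s ≤ p)
    (hsε : s ≤ 1 / 100 * (ε / D) * √(p / Real.log (4 * L * R * √p / ε))) (hr0 : 0 ≤ r)
    (hr : r ≤ R) (he₁ : 0 ≤ e₁) (he₂ : 0 ≤ e₂) (h₁ : ∀ A B, M₁.model A 0 = M₁.model B 0)
    (h₂ : ∀ A B, M₂.model A 0 = M₂.model B 0)
    (him₁ : 0 < p → ∀ k : ℕ, 0 < k → 20 * k * s ≤ p → ∀ f : ℕ → E,
      (∀ i, f i ∈ M₁.submodels s r) →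
      ∃ A : Arch M₁.inputs M₁.hiddenLayers M₁.outputs, A.numParams ≤ p ∧ ∃ w ∈ A.box R,
        mix k f ∈ M₁.hull p R → ∀ q ∈ M₂.hull p R, Φ (mix k f) q ≤ Φ (M₁.model A w) q + e₁)
    (him₂ : 0 < p → ∀ k : ℕ, 0 < k → 20 * k * s ≤ p → ∀ q : ℕ → F,
      (∀ i, q i ∈ M₂.submodels s r) →
      ∃ B : Arch M₂.inputs M₂.hiddenLayers M₂.outputs, B.numParams ≤ p ∧ ∃ θ ∈ B.box R,
        mix k q ∈ M₂.hull p R → ∀ f ∈ M₁.hull p R, Φ f (M₂.model B θ) ≤ Φ f (mix k q) + e₂) :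
    HasLimitedCapacityEquilibrium M₁ M₂ Φ p R s r (ε + (e₁ + e₂)) := by
  by_cases hsmall : 2 * D ≤ ε ∨ 2 * (L * (√s * r)) ≤ ε
  · exact equilibrium_of_small hΦ hR.le hL.le hs hr0 hr h₁ h₂
      (hsmall.imp (fun h => by linarith) fun h => by linarith)
  push Not at hsmall
  obtain ⟨hεD, hεL⟩ := hsmall
  -- For `s = 0` the second trivial case applies; this covers a nonpositive logarithm, where the
  -- root in `hsε` is `0`.
  have hs0 : 0 < s := by
    rcases Nat.eq_zero_or_pos s with rfl | h
    · simp at hεL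
      linarith
    · exact h
  have hp0 : 0 < p := hs0.trans_le hs
  have hp0' : (0 : ℝ) < p := by exact_mod_cast hp0
  have hsp : √(s : ℝ) ≤ √p := Real.sqrt_le_sqrt (by exact_mod_cast hs)
  have hsqp : 0 < √(p : ℝ) := Real.sqrt_pos.2 hp0'
  set Λ : ℝ := 4 * L * R * √p / ε with hΛ
  -- Outside of the trivial cases `ε < 2 L √s r ≤ 2 L √p R`, so the logarithm is at least `log 2`.
  have hΛ2 : 2 ≤ Λ := by
    rw [hΛ, le_div_iff₀ hε]
    have : L * (√s * r) ≤ L * (√p * R) := by gcongr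
    linarith
  set l := Real.log Λ with hl
  have hl2 : Real.log 2 ≤ l := Real.log_le_log two_pos hΛ2
  have hl0 : 0 < l := (Real.log_pos one_lt_two).trans_le hl2
  set η : ℝ := ε / (4 * L * √p) with hη
  have hη0 : 0 < η := by positivity
  have hηs : L * (√s * η) ≤ ε / 4 := by
    calc L * (√s * η) ≤ L * (√p * η) := by gcongr
      _ = ε / 4 := by rw [hη]; field_simp
  obtain ⟨I, _, f, hIcard, hf, hfnet⟩ := M₁.exists_net s (r := r) hη0
  obtain ⟨J, _, q, hJcard, hq, hqnet⟩ := M₂.exists_net s (r := r) hη0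
  have hfm : ∀ i, f i ∈ M₁.models p R := fun i => M₁.submodels_subset_models hs hr (hf i)
  have hqm : ∀ j, q j ∈ M₂.models p R := fun j => M₂.submodels_subset_models hs hr (hq j)
  by_cases hne : Nonempty I ∧ Nonempty J
  swap
  · refine ⟨emptyArch _ _ _, by simp [numParams_emptyArch], emptyArch _ _ _,
      by simp [numParams_emptyArch], 0, Arch.zero_mem_box _ hR.le, 0, Arch.zero_mem_box _ hR.le, ?_⟩
    intro S hS hSs T hT hTs w hw hwa θ hθ hθa
    obtain ⟨i, -⟩ := hfnet S hS hSs w hw hwa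
    obtain ⟨j, -⟩ := hqnet T hT hTs θ hθ hθa
    exact absurd ⟨⟨i⟩, ⟨j⟩⟩ hne
  obtain ⟨_, _⟩ := hne
  set k := ⌈256 * (D / ε) ^ 2 * s * l⌉₊ with hkdef
  have hs0' : (0 : ℝ) < s := by exact_mod_cast hs0
  have hk0 : 0 < k := Nat.ceil_pos.2 (by positivity)
  have hk0' : (0 : ℝ) < k := by exact_mod_cast hk0
  have hk := Nat.le_ceil (256 * (D / ε) ^ 2 * s * l)
  rw [← hkdef] at hk
  have hksp : 20 * k * s ≤ p := mul_mixture_size_le hε hD hεD.le hl2 hs0 hsε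
    (Nat.ceil_lt_add_one (by positivity)).le
  have hx : 2 * r / η ≤ 2 * Λ := by
    calc 2 * r / η ≤ 2 * R / η := by gcongr
      _ = 2 * Λ := by rw [hΛ, hη]; field_simp
  have hlogI := log_card_net_le hΛ2 (by positivity) hx Fintype.card_pos hIcard
  have hlogJ := log_card_net_le hΛ2 (by positivity) hx Fintype.card_pos hJcard
  -- With this learning rate the quadratic terms of the two regrets cost `ε/4` per round, and by the
  -- choice of `k` the entropy terms cost at most another `ε/4`.
  obtain ⟨x, y, hxy⟩ := exists_sparse_equilibrium (fun i j => Φ (f i) (q j))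
    (η := ε / (8 * D ^ 2)) (D := D) (by positivity)
    (by rw [div_mul_eq_mul_div, div_le_one (by positivity)]; nlinarith)
    (fun i j => by
      obtain ⟨A, hA, w, hw, hfi⟩ := hfm i
      obtain ⟨B, hB, θ, hθ, hqj⟩ := hqm j
      rw [hfi, hqj]
      exact hΦ.bounded A hA B hB w hw θ hθ) k
  have herr : Real.log (Fintype.card I) / (ε / (8 * D ^ 2)) +
      Real.log (Fintype.card J) / (ε / (8 * D ^ 2)) + 2 * k * (ε / (8 * D ^ 2) * D ^ 2) ≤
      k * (ε / 2) := by
    have a1 : Real.log (Fintype.card I) / (ε / (8 * D ^ 2)) ≤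
        4 * s * l / (ε / (8 * D ^ 2)) := by gcongr
    have a2 : Real.log (Fintype.card J) / (ε / (8 * D ^ 2)) ≤
        4 * s * l / (ε / (8 * D ^ 2)) := by gcongr
    have a3 : 4 * s * l / (ε / (8 * D ^ 2)) = 256 * (D / ε) ^ 2 * s * l * (ε / 8) := by
      field_simp; ring
    have a4 : 2 * k * (ε / (8 * D ^ 2) * D ^ 2) = k * (ε / 4) := by field_simp; ring
    have a5 := mul_le_mul_of_nonneg_right hk (by positivity : 0 ≤ ε / 8)
    linarith
  have hfx : ∀ i, f (x i) ∈ M₁.hull p R := fun i => M₁.models_subset_hull _ _ (hfm _)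
  have hqy : ∀ i, q (y i) ∈ M₂.hull p R := fun i => M₂.models_subset_hull _ _ (hqm _)
  obtain ⟨A, hA, wStar, hwS, hAw⟩ := him₁ hp0 k hk0 hksp (fun t => f (x t)) fun t => hf _
  obtain ⟨B, hB, θStar, hθS, hBθ⟩ := him₂ hp0 k hk0 hksp (fun t => q (y t)) fun t => hq _
  refine ⟨A, hA, B, hB, wStar, hwS, θStar, hθS, ?_⟩
  intro S hS hSs T hT hTs w hw hwa θ hθ hθa
  obtain ⟨i, v, hv, hfi, hwv⟩ := hfnet S hS hSs w hw hwa
  obtain ⟨j, τ, hτ, hqj, hθτ⟩ := hqnet T hT hTs θ hθ hθa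
  have hSm : M₁.model S w ∈ M₁.hull p R :=
    M₁.models_subset_hull _ _ ⟨S, hSs.trans hs, w, box_mono hr hw, rfl⟩
  have hTm : M₂.model T θ ∈ M₂.hull p R :=
    M₂.models_subset_hull _ _ ⟨T, hTs.trans hs, θ, box_mono hr hθ, rfl⟩
  obtain ⟨hmixq, hΦq⟩ := hΦ.mix_right hk0 hSm hqy
  obtain ⟨hmixf, hΦf⟩ := hΦ.mix_left hk0 hfx hTm
  have u₁ := hBθ hmixq _ hSm
  have u₂ := hAw hmixf _ hTm
  -- The Lipschitz condition concerns networks, not mixtures, so the rounding is done against each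
  -- member of the mixture.
  have v₁ : ∑ t ∈ Finset.range k, Φ (M₁.model S w) (q (y t)) ≤
      ∑ t ∈ Finset.range k, Φ (f i) (q (y t)) + k * (ε / 4) := by
    refine (Finset.sum_le_sum fun t _ => (?_ : _ ≤ Φ (f i) (q (y t)) + ε / 4)).trans
      (by rw [Finset.sum_add_distrib]; simp)
    rw [hfi]
    refine (hΦ.lipschitz_left (hSs.trans hs) (box_mono hr hw) (box_mono hr hv) (hqm _)).trans ?_
    have := mul_le_mul_of_nonneg_left hwv hL.le
    linarith
  have v₂ : ∑ t ∈ Finset.range k, Φ (f (x t)) (q j) ≤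
      ∑ t ∈ Finset.range k, Φ (f (x t)) (M₂.model T θ) + k * (ε / 4) := by
    refine (Finset.sum_le_sum fun t _ =>
      (?_ : _ ≤ Φ (f (x t)) (M₂.model T θ) + ε / 4)).trans
      (by rw [Finset.sum_add_distrib]; simp)
    rw [hqj]
    refine (hΦ.lipschitz_right (hfm _) (hTs.trans hs) (box_mono hr hθ) (box_mono hr hτ)).trans ?_
    have := mul_le_mul_of_nonneg_left hθτ hL.le
    linarith
  have hij := hxy i j
  have hkey : k * Φ (M₁.model S w) (mix k fun t => q (y t)) ≤
      k * (Φ (mix k fun t => f (x t)) (M₂.model T θ) + ε) := by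
    rw [mul_add, hΦq, hΦf]
    linarith
  have := le_of_mul_le_mul_left hkey hk0'
  linarith

end Equilibrium

lemma subnetSize_le (c ε D L R : ℝ) (p : ℕ) : subnetSize c ε D L R p ≤ p := min_le_left _ _

lemma cast_subnetSize_le {c ε D : ℝ} (hc : 0 ≤ c) (hε : 0 ≤ ε) (hD : 0 ≤ D) (L R : ℝ) (p : ℕ) :
    (subnetSize c ε D L R p : ℝ) ≤ c * (ε / D) * √(p / Real.log (4 * L * R * √p / ε)) :=
  (Nat.cast_le.2 (min_le_right _ _)).trans (Nat.floor_le (by positivity))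

lemma subnetBound_nonneg {R : ℝ} (hR : 0 ≤ R) (c ε D L : ℝ) (p : ℕ) :
    0 ≤ subnetBound c ε D L R p := by
  unfold subnetBound
  positivity

lemma subnetBound_le {R : ℝ} (hR : 0 ≤ R) (c ε D L : ℝ) (p : ℕ) :
    subnetBound c ε D L R p ≤ R := by
  unfold subnetBound
  refine div_le_of_le_mul₀ (by positivity) hR ?_
  gcongr
  exact subnetSize_le _ _ _ _ _ _

lemma functionClass_model_zero {σ : ℝ → ℝ} {m h d : ℕ} (A B : Arch m h d) :
    (functionClass σ m h d).model A 0 = (functionClass σ m h d).model B 0 :=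
  (A.fn_zero σ).trans (B.fn_zero σ).symm

lemma distributionClass_model_zero {h d : ℕ} (A B : Arch 1 h d) :
    (distributionClass h d).model A 0 = (distributionClass h d).model B 0 := by
  have hg : generator A 0 = generator B 0 := by
    funext z
    rw [generator, generator, A.fn_zero, B.fn_zero]
  exact congrArg (fun g => (volume.restrict (Set.Icc (0 : ℝ) 1)).map g) hg

end NetGame

open NetGame in
theorem theorem1 :
    ∃ c : ℝ, 0 < c ∧ ∀ (p : ℕ) (R L D K ε : ℝ), 0 < R → 0 < L → 0 < D → 0 ≤ K → 0 < ε →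
      -- function vs. function
      (∀ (σ₁ σ₂ : ℝ → ℝ) (m₁ h₁ d₁ m₂ h₂ d₂ : ℕ)
        (Φ : ((Fin m₁ → ℝ) → (Fin d₁ → ℝ)) → ((Fin m₂ → ℝ) → (Fin d₂ → ℝ)) → ℝ),
        IsGame (functionClass σ₁ m₁ h₁ d₁) (functionClass σ₂ m₂ h₂ d₂) Φ p R L D →
        HasLimitedCapacityEquilibrium (functionClass σ₁ m₁ h₁ d₁) (functionClass σ₂ m₂ h₂ d₂) Φ
          p R (subnetSize c ε D L R p) R ε) ∧
      -- function vs. distribution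
      (∀ (σ : ℝ → ℝ) (m₁ h₁ d₁ h₂ d₂ : ℕ), 1 ≤ h₂ →
        ∀ Φ : ((Fin m₁ → ℝ) → (Fin d₁ → ℝ)) → MeasureTheory.Measure (Fin d₂ → ℝ) → ℝ,
        IsGame (functionClass σ m₁ h₁ d₁) (distributionClass h₂ d₂) Φ p R L D →
        TVLipschitzRight (functionClass σ m₁ h₁ d₁) (distributionClass h₂ d₂) Φ p R K →
        HasLimitedCapacityEquilibrium (functionClass σ m₁ h₁ d₁) (distributionClass h₂ d₂) Φ
          p R (subnetSize c ε D L R p) (subnetBound c ε D L R p) (ε + K / R)) ∧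
      -- distribution vs. function
      (∀ (σ : ℝ → ℝ) (h₁ d₁ m₂ h₂ d₂ : ℕ), 1 ≤ h₁ →
        ∀ Φ : MeasureTheory.Measure (Fin d₁ → ℝ) → ((Fin m₂ → ℝ) → (Fin d₂ → ℝ)) → ℝ,
        IsGame (distributionClass h₁ d₁) (functionClass σ m₂ h₂ d₂) Φ p R L D →
        TVLipschitzLeft (distributionClass h₁ d₁) (functionClass σ m₂ h₂ d₂) Φ p R K →
        HasLimitedCapacityEquilibrium (distributionClass h₁ d₁) (functionClass σ m₂ h₂ d₂) Φ
          p R (subnetSize c ε D L R p) (subnetBound c ε D L R p) (ε + K / R)) ∧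
      -- distribution vs. distribution
      (∀ (h₁ d₁ h₂ d₂ : ℕ), 1 ≤ h₁ → 1 ≤ h₂ →
        ∀ Φ : MeasureTheory.Measure (Fin d₁ → ℝ) → MeasureTheory.Measure (Fin d₂ → ℝ) → ℝ,
        IsGame (distributionClass h₁ d₁) (distributionClass h₂ d₂) Φ p R L D →
        TVLipschitzLeft (distributionClass h₁ d₁) (distributionClass h₂ d₂) Φ p R K →
        TVLipschitzRight (distributionClass h₁ d₁) (distributionClass h₂ d₂) Φ p R K →
        HasLimitedCapacityEquilibrium (distributionClass h₁ d₁) (distributionClass h₂ d₂) Φ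
          p R (subnetSize c ε D L R p) (subnetBound c ε D L R p) (ε + 2 * K / R)) := by
  refine ⟨1 / 100, by norm_num, fun p R L D K ε hR hL hD hK hε => ?_⟩
  have hs := subnetSize_le (1 / 100) ε D L R p
  have hsε := cast_subnetSize_le (c := 1 / 100) (by norm_num) hε.le hD.le L R p
  have hb0 := subnetBound_nonneg hR.le (1 / 100) ε D L p
  have hbR := subnetBound_le hR.le (1 / 100) ε D L p
  have hKR : 0 ≤ K / R := by positivity
  have hKtv : ∀ {x : ℝ}, x ≤ 1 / R → K * x ≤ K / R := fun {x} hx => by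
    rw [div_eq_mul_one_div]
    exact mul_le_mul_of_nonneg_left hx hK
  have hksp : ∀ {k s : ℕ}, 20 * k * s ≤ p → k * s ≤ p := fun {k s} h => by nlinarith
  refine ⟨?_, ?_, ?_, ?_⟩
  · intro σ₁ σ₂ m₁ h₁ d₁ m₂ h₂ d₂ Φ hΦ
    have := equilibrium_of_imitation hΦ hR hL hD (e₁ := 0) (e₂ := 0) hε hs hsε hR.le le_rfl le_rfl
      le_rfl functionClass_model_zero functionClass_model_zero
      (fun _ k hk hp f hf => by
        obtain ⟨A, hA, w, hw, hAw⟩ := exists_model_eq_mix hR.le hk (hksp hp) hf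
        exact ⟨A, hA, w, hw, fun _ q _ => by rw [hAw, add_zero]⟩)
      (fun _ k hk hp f hf => by
        obtain ⟨A, hA, w, hw, hAw⟩ := exists_model_eq_mix hR.le hk (hksp hp) hf
        exact ⟨A, hA, w, hw, fun _ q _ => by rw [hAw, add_zero]⟩)
    simpa using this
  · intro σ m₁ h₁ d₁ h₂ d₂ hh₂ Φ hΦ hTV
    have := equilibrium_of_imitation hΦ hR hL hD (e₁ := 0) (e₂ := K / R) hε hs hsε hb0 hbR le_rfl
      hKR functionClass_model_zero distributionClass_model_zero
      (fun _ k hk hp f hf => by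
        -- Averaging stays inside the smaller box of the subnetworks.
        obtain ⟨A, hA, w, hw, hAw⟩ := exists_model_eq_mix hb0 hk (hksp hp) hf
        exact ⟨A, hA, w, box_mono hbR hw, fun _ q _ => by rw [hAw, add_zero]⟩)
      (fun hp0 k hk hp q hq => by
        obtain ⟨B, hB, θ, hθ, hBθ⟩ := exists_tvDist_mix_le hh₂ hR hk hp0 hp hq
        refine ⟨B, hB, θ, hθ, fun hmix f hf => ?_⟩
        have h3 := (abs_le.1 (hTV f hf _
          (ModelClass.models_subset_hull _ _ _ ⟨B, hB, θ, hθ, rfl⟩) _ hmix)).2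
        linarith [hKtv hBθ])
    simpa using this
  · intro σ h₁ d₁ m₂ h₂ d₂ hh₁ Φ hΦ hTV
    have := equilibrium_of_imitation hΦ hR hL hD (e₁ := K / R) (e₂ := 0) hε hs hsε hb0 hbR hKR
      le_rfl distributionClass_model_zero functionClass_model_zero
      (fun hp0 k hk hp q hq => by
        obtain ⟨A, hA, w, hw, hAw⟩ := exists_tvDist_mix_le hh₁ hR hk hp0 hp hq
        refine ⟨A, hA, w, hw, fun hmix f hf => ?_⟩
        have h3 := (abs_le.1 (hTV _ (ModelClass.models_subset_hull _ _ _ ⟨A, hA, w, hw, rfl⟩) _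
          hmix f hf)).1
        linarith [hKtv hAw])
      (fun _ k hk hp f hf => by
        obtain ⟨A, hA, w, hw, hAw⟩ := exists_model_eq_mix hb0 hk (hksp hp) hf
        exact ⟨A, hA, w, box_mono hbR hw, fun _ q _ => by rw [hAw, add_zero]⟩)
    simpa using this
  · intro h₁ d₁ h₂ d₂ hh₁ hh₂ Φ hΦ hTV₁ hTV₂
    have := equilibrium_of_imitation hΦ hR hL hD (e₁ := K / R) (e₂ := K / R) hε hs hsε hb0 hbR hKR
      hKR distributionClass_model_zero distributionClass_model_zero
      (fun hp0 k hk hp q hq => by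
        obtain ⟨A, hA, w, hw, hAw⟩ := exists_tvDist_mix_le hh₁ hR hk hp0 hp hq
        refine ⟨A, hA, w, hw, fun hmix f hf => ?_⟩
        have h3 := (abs_le.1 (hTV₁ _ (ModelClass.models_subset_hull _ _ _ ⟨A, hA, w, hw, rfl⟩) _
          hmix f hf)).1
        linarith [hKtv hAw])
      (fun hp0 k hk hp q hq => by
        obtain ⟨B, hB, θ, hθ, hBθ⟩ := exists_tvDist_mix_le hh₂ hR hk hp0 hp hq
        refine ⟨B, hB, θ, hθ, fun hmix f hf => ?_⟩
        have h3 := (abs_le.1 (hTV₂ f hf _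
          (ModelClass.models_subset_hull _ _ _ ⟨B, hB, θ, hθ, rfl⟩) _ hmix)).2
        linarith [hKtv hBθ])
    rwa [← two_mul, ← mul_div_assoc] at this
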